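/- Let $M\ge 1$ be an integer, $h>0$, $X_j=jh$ and $I_j=[X_j-h,X_j+h]$ for $j=1,\dots,M$, and let $\mathcal H=\prod_{j=1}^M L^2(I_j)$ (real-valued functions), with $\langle u,v\rangle=\sum_j\int_{I_j}u_jv_j\,dx$. The index $j$ is read cyclically modulo $M$ and space periodically with period $L=Mh$, so that the grid point $X_j$ is the centre of element $j$, the right end of element $j-1$ and the left end of element $j+1$. For $0\le\gamma\le1$ let $\mathcal L_\gamma$ be the operator in $\mathcal H$ given by $\mathcal L_\gamma u=(\partial^2u_j/\partial x^2)_j$ (second derivatives taken separately on the two halves of each element), whose domain consists of all $u=(u_j)\in\mathcal H$ such that each $u_j$ is continuous on $I_j$ and belongs to $H^2$ on each of the halves $(X_j-h,X_j)$ and $(X_j,X_j+h)$, and such that for all $j$ \[ u_j(X_{j\pm1})=(1-\gamma)u_j(X_j)+\gamma u_{j\pm1}(X_{j\pm1}), \] \[ u_{j,x}(X_j^-)-u_{j,x}(X_j^+)+\gamma u_{j-1,x}(X_j)-\gamma u_{j+1,x}(X_j)-(1-\gamma)u_{j,x}(X_{j-1})+(1-\gamma)u_{j,x}(X_{j+1})=0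 . \] The eigenvalues of $-\mathcal L_0$ are exactly the numbers $\lambda_k=k^2\pi^2/h^2$, $k=0,1,2,\dots$, each of finite multiplicity $m_k=\dim E_k$, where $E_k=\{u: -\mathcal L_0u=\lambda_ku\}$. For every $\gamma\in(0,1]$ there is a complete orthonormal system of eigenvectors of $-\mathcal L_\gamma$ in $\mathcal H$ whose eigenvalues, repeated according to multiplicity, form a nondecreasing sequence. For each $\gamma\in(0,1]$ choose any such system and number it, together with its eigenvalues, in groups of $m_0,m_1,m_2,\dots$ consecutive members: \[ \lambda_0^1(\gamma)\le\dots\le\lambda_0^{m_0}(\gamma)\le\lambda_1^1(\gamma)\le\dots\le\lambda_1^{m_1}(\gamma)\le\lambda_2^1(\gamma)\le\cdots,\qquad -\mathcal L_\gamma e_k^{\gamma,l}=\lambda_k^l(\gamma)e_k^{\gamma,l}. \] Then for every $k=0,1,2,\dots$: 1. $\lim_{\gamma\to0^+}\lambda_k^l(\gamma)=\lambda_k=k^2\pi^2/h^2$ for every $l=1,\dots,m_k$; 2. the $m_k$-dimensional subspaces $\mathbb L_k^\gamma=\operatorname{span}(e_k^{\gamma,1},\dots,e_k^{\gamma,m_k})$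 converge in $\mathcal H$ to $E_k$ in the sense of Mosco as $\gamma\to0^+$: for every sequence $\gamma_n\in(0,1]$ with $\gamma_n\to0$, every $u\in E_k$ is the strong limit of some $u^n\in\mathbb L_k^{\gamma_n}$, and every weak limit of a sequence $u^i\in\mathbb L_k^{\gamma_{n_i}}$, with $n_1<n_2<\cdots$, belongs to $E_k$. -/

import Mathlib

open MeasureTheory Set Filter Topology

noncomputable section

namespace CoupledElements

/-- `w` belongs to the Sobolev space `H¹(a, b)` (it is the absolutely continuous representative)
and `p` is its weak derivative: `p` is square integrable and `w` is a primitive of `p`. -/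
def IsH1Deriv (a b : ℝ) (w p : ℝ → ℝ) : Prop :=
  MemLp p 2 (volume.restrict (Icc a b)) ∧ ∀ x ∈ Icc a b, w x = w a + ∫ t in a..x, p t

/-- The grid points `X₁ = h, …, X_M = M h`; the index `j : Fin M` stands for element `j + 1`. -/
def gridPoint {M : ℕ} (h : ℝ) (j : Fin M) : ℝ := ((j : ℝ) + 1) * h

/-- The `j`-th element `I_j = [X_j - h, X_j + h]`. -/
def element {M : ℕ} (h : ℝ) (j : Fin M) : Set ℝ := Icc (gridPoint h j - h) (gridPoint h j + h)

/-- The Hilbert space `∏ⱼ L²(I_j)`, with inner product the sum of the element integrals. -/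
abbrev StateSpace (M : ℕ) (h : ℝ) : Type :=
  PiLp 2 (fun j : Fin M => Lp ℝ 2 (volume.restrict (element h j)))

/-- `u` lies in the domain of the coupled operator and `v` is its second derivative, witnessed by
`w j`, the continuous representative of `u j` on `I_j`, and by `pl j` and `pr j`, its derivative on
the left half `[X_j - h, X_j]` and on the right half `[X_j, X_j + h]`. On each half `w j` is in
`H²`. Addition in `Fin M` is cyclic, which expresses the `L`-periodicity (`L = M h`): the grid
point `X_j` is the right end of element `j - 1` and the left end of element `j + 1`. -/
structure IsCoupledRep {M : ℕ} [NeZero M] {h : ℝ} (γ : ℝ) (u v : StateSpace M h)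
    (w pl pr : Fin M → ℝ → ℝ) : Prop where
  ae_eq : ∀ j, w j =ᵐ[volume.restrict (element h j)] u j
  deriv_left : ∀ j, IsH1Deriv (gridPoint h j - h) (gridPoint h j) (w j) (pl j)
  deriv_right : ∀ j, IsH1Deriv (gridPoint h j) (gridPoint h j + h) (w j) (pr j)
  deriv2_left : ∀ j, IsH1Deriv (gridPoint h j - h) (gridPoint h j) (pl j) (v j)
  deriv2_right : ∀ j, IsH1Deriv (gridPoint h j) (gridPoint h j + h) (pr j) (v j)
  value_right : ∀ j, w j (gridPoint h j + h) =
    (1 - γ) * w j (gridPoint h j) + γ * w (j + 1) (gridPoint h (j + 1))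
  value_left : ∀ j, w j (gridPoint h j - h) =
    (1 - γ) * w j (gridPoint h j) + γ * w (j - 1) (gridPoint h (j - 1))
  flux : ∀ j, pl j (gridPoint h j) - pr j (gridPoint h j)
    + γ * pr (j - 1) (gridPoint h (j - 1) + h) - γ * pl (j + 1) (gridPoint h (j + 1) - h)
    - (1 - γ) * pl j (gridPoint h j - h) + (1 - γ) * pr j (gridPoint h j + h) = 0

theorem IsH1Deriv.intervalIntegrable {a b : ℝ} {w p : ℝ → ℝ} (H : IsH1Deriv a b w p) {x : ℝ}
    (hx : x ∈ Icc a b) : IntervalIntegrable p volume a x := by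
  have h1 : IntegrableOn p (Icc a b) volume := H.1.integrable (by norm_num)
  rw [intervalIntegrable_iff_integrableOn_Icc_of_le hx.1]
  exact h1.mono_set (Icc_subset_Icc le_rfl hx.2)

theorem IsH1Deriv.congr {a b : ℝ} {w p q : ℝ → ℝ} (H : IsH1Deriv a b w p)
    (hq : p =ᵐ[volume.restrict (Icc a b)] q) : IsH1Deriv a b w q := by
  refine ⟨H.1.ae_eq hq, fun x hx => ?_⟩
  rw [H.2 x hx]
  congr 1
  apply intervalIntegral.integral_congr_ae_restrict
  refine ae_restrict_of_ae_restrict_of_subset ?_ hq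
  rw [uIoc_of_le hx.1]
  exact Ioc_subset_Icc_self.trans (Icc_subset_Icc le_rfl hx.2)

theorem IsH1Deriv.add {a b : ℝ} {w p w' p' : ℝ → ℝ} (H : IsH1Deriv a b w p)
    (H' : IsH1Deriv a b w' p') : IsH1Deriv a b (w + w') (p + p') := by
  refine ⟨H.1.add H'.1, fun x hx => ?_⟩
  have e : ∫ t in a..x, (p + p') t = (∫ t in a..x, p t) + ∫ t in a..x, p' t :=
    intervalIntegral.integral_add (H.intervalIntegrable hx) (H'.intervalIntegrable hx)
  rw [e, Pi.add_apply, Pi.add_apply, H.2 x hx, H'.2 x hx]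
  ring

theorem IsH1Deriv.smul {a b : ℝ} {w p : ℝ → ℝ} (c : ℝ) (H : IsH1Deriv a b w p) :
    IsH1Deriv a b (c • w) (c • p) := by
  refine ⟨H.1.const_smul c, fun x hx => ?_⟩
  have e : ∫ t in a..x, (c • p) t = c • ∫ t in a..x, p t := intervalIntegral.integral_smul c p
  rw [e, Pi.smul_apply, Pi.smul_apply, H.2 x hx]
  simp only [smul_eq_mul]
  ring

theorem IsH1Deriv.continuousOn {a b : ℝ} (hab : a ≤ b) {w p : ℝ → ℝ} (H : IsH1Deriv a b w p) :
    ContinuousOn w (Icc a b) := by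
  have h2 : ContinuousOn (fun x => w a + ∫ t in a..x, p t) (Icc a b) :=
    continuousOn_const.add ((intervalIntegral.continuousOn_primitive_interval'
      (H.intervalIntegrable (right_mem_Icc.2 hab)) left_mem_uIcc).mono Icc_subset_uIcc)
  exact h2.congr H.2

theorem IsH1Deriv.ae_zero {a b : ℝ} (hab : a < b) {w p : ℝ → ℝ} (H : IsH1Deriv a b w p)
    (hw : w =ᵐ[volume.restrict (Icc a b)] 0) : p =ᵐ[volume.restrict (Icc a b)] 0 := by
  have hw0 : EqOn w 0 (Icc a b) := Measure.eqOn_Icc_of_ae_eq volume hab.ne hw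
    (H.continuousOn hab.le) continuousOn_const
  have hint : ∀ x ∈ Icc a b, ∫ t in a..x, p t = 0 := fun x hx => by
    have := H.2 x hx
    rw [hw0 hx, hw0 (left_mem_Icc.2 hab.le)] at this
    simpa using this.symm
  rw [Measure.restrict_congr_set Ioo_ae_eq_Icc.symm]
  rw [EventuallyEq, ae_restrict_iff' measurableSet_Ioo]
  filter_upwards [(H.intervalIntegrable (right_mem_Icc.2 hab.le)).ae_hasDerivAt_integral]
    with x hx hxI
  have h1 := hx (Icc_subset_uIcc (Ioo_subset_Icc_self hxI)) a left_mem_uIcc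
  have h2 : HasDerivAt (fun y => ∫ t in a..y, p t) 0 x := by
    refine (hasDerivAt_const x (0 : ℝ)).congr_of_eventuallyEq ?_
    filter_upwards [Ioo_mem_nhds hxI.1 hxI.2] with y hy
    exact hint y (Ioo_subset_Icc_self hy)
  exact h1.unique h2

theorem left_subset_element {M : ℕ} {h : ℝ} (hh : 0 ≤ h) (j : Fin M) :
    Icc (gridPoint h j - h) (gridPoint h j) ⊆ element h j :=
  Icc_subset_Icc le_rfl (by linarith)

theorem right_subset_element {M : ℕ} {h : ℝ} (hh : 0 ≤ h) (j : Fin M) :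
    Icc (gridPoint h j) (gridPoint h j + h) ⊆ element h j :=
  Icc_subset_Icc (by linarith) le_rfl

theorem element_eq_union {M : ℕ} {h : ℝ} (hh : 0 ≤ h) (j : Fin M) :
    element h j = Icc (gridPoint h j - h) (gridPoint h j) ∪
      Icc (gridPoint h j) (gridPoint h j + h) :=
  (Icc_union_Icc_eq_Icc (by linarith) (by linarith)).symm

theorem IsCoupledRep.add {M : ℕ} [NeZero M] {h : ℝ} (hh : 0 ≤ h) {γ : ℝ}
    {u v u' v' : StateSpace M h} {w pl pr w' pl' pr' : Fin M → ℝ → ℝ}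
    (H : IsCoupledRep γ u v w pl pr) (H' : IsCoupledRep γ u' v' w' pl' pr') :
    IsCoupledRep γ (u + u') (v + v') (w + w') (pl + pl') (pr + pr') := by
  have hv : ∀ j, (v j + v' j : ℝ → ℝ) =ᵐ[volume.restrict (element h j)] (v + v') j :=
    fun j => (Lp.coeFn_add (v j) (v' j)).symm
  refine ⟨fun j => ?_, fun j => (H.deriv_left j).add (H'.deriv_left j),
    fun j => (H.deriv_right j).add (H'.deriv_right j),
    fun j => ((H.deriv2_left j).add (H'.deriv2_left j)).congr
      (ae_restrict_of_ae_restrict_of_subset (left_subset_element hh j) (hv j)),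
    fun j => ((H.deriv2_right j).add (H'.deriv2_right j)).congr
      (ae_restrict_of_ae_restrict_of_subset (right_subset_element hh j) (hv j)),
    fun j => ?_, fun j => ?_, fun j => ?_⟩
  · exact ((H.ae_eq j).add (H'.ae_eq j)).trans (Lp.coeFn_add (u j) (u' j)).symm
  · simp only [Pi.add_apply]
    linear_combination H.value_right j + H'.value_right j
  · simp only [Pi.add_apply]
    linear_combination H.value_left j + H'.value_left j
  · simp only [Pi.add_apply]
    linear_combination H.flux j + H'.flux j

theorem IsCoupledRep.smul {M : ℕ} [NeZero M] {h : ℝ} (hh : 0 ≤ h) {γ : ℝ} (c : ℝ)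
    {u v : StateSpace M h} {w pl pr : Fin M → ℝ → ℝ} (H : IsCoupledRep γ u v w pl pr) :
    IsCoupledRep γ (c • u) (c • v) (c • w) (c • pl) (c • pr) := by
  have hv : ∀ j, (c • (v j : ℝ → ℝ)) =ᵐ[volume.restrict (element h j)] (c • v) j :=
    fun j => (Lp.coeFn_smul c (v j)).symm
  refine ⟨fun j => ?_, fun j => (H.deriv_left j).smul c, fun j => (H.deriv_right j).smul c,
    fun j => ((H.deriv2_left j).smul c).congr
      (ae_restrict_of_ae_restrict_of_subset (left_subset_element hh j) (hv j)),
    fun j => ((H.deriv2_right j).smul c).congr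
      (ae_restrict_of_ae_restrict_of_subset (right_subset_element hh j) (hv j)),
    fun j => ?_, fun j => ?_, fun j => ?_⟩
  · exact ((H.ae_eq j).const_smul c).trans (Lp.coeFn_smul c (u j)).symm
  · simp only [Pi.smul_apply, smul_eq_mul]
    linear_combination c * H.value_right j
  · simp only [Pi.smul_apply, smul_eq_mul]
    linear_combination c * H.value_left j
  · simp only [Pi.smul_apply, smul_eq_mul]
    linear_combination c * H.flux j

theorem IsCoupledRep.zero (M : ℕ) [NeZero M] {h : ℝ} (hh : 0 ≤ h) (γ : ℝ) :
    IsCoupledRep γ (0 : StateSpace M h) 0 0 0 0 := by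
  have h0 : ∀ a b : ℝ, IsH1Deriv a b 0 0 := fun a b => ⟨MemLp.zero, fun x _ => by simp⟩
  have hv : ∀ j, (0 : ℝ → ℝ) =ᵐ[volume.restrict (element h j)] (0 : StateSpace M h) j :=
    fun j => (Lp.coeFn_zero ℝ 2 _).symm
  exact ⟨hv, fun j => h0 _ _, fun j => h0 _ _,
    fun j => (h0 _ _).congr
      (ae_restrict_of_ae_restrict_of_subset (left_subset_element hh j) (hv j)),
    fun j => (h0 _ _).congr
      (ae_restrict_of_ae_restrict_of_subset (right_subset_element hh j) (hv j)),
    by simp, by simp, by simp⟩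

/-- The graph `{(u, v) | u ∈ D(𝓛_γ), v = 𝓛_γ u}` of the coupled operator. -/
def coupledGraph (M : ℕ) [NeZero M] (h : ℝ) (hh : 0 < h) (γ : ℝ) :
    Submodule ℝ (StateSpace M h × StateSpace M h) where
  carrier := {x | ∃ w pl pr : Fin M → ℝ → ℝ, IsCoupledRep γ x.1 x.2 w pl pr}
  add_mem' := by
    rintro x y ⟨w, pl, pr, H⟩ ⟨w', pl', pr', H'⟩
    exact ⟨_, _, _, H.add hh.le H'⟩
  zero_mem' := ⟨_, _, _, IsCoupledRep.zero M hh.le γ⟩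
  smul_mem' := by
    rintro c x ⟨w, pl, pr, H⟩
    exact ⟨_, _, _, H.smul hh.le c⟩

theorem coupledGraph_functional (M : ℕ) [NeZero M] (h : ℝ) (hh : 0 < h) (γ : ℝ)
    (x : StateSpace M h × StateSpace M h) (hx : x ∈ coupledGraph M h hh γ) (hx1 : x.1 = 0) :
    x.2 = 0 := by
  obtain ⟨w, pl, pr, H⟩ := hx
  ext j : 1
  refine Lp.ext ?_
  have hw : w j =ᵐ[volume.restrict (element h j)] 0 := by
    refine (H.ae_eq j).trans ?_
    rw [hx1]
    exact Lp.coeFn_zero ℝ 2 _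
  have hl := (H.deriv2_left j).ae_zero (by linarith) ((H.deriv_left j).ae_zero (by linarith)
    (ae_restrict_of_ae_restrict_of_subset (left_subset_element hh.le j) hw))
  have hr := (H.deriv2_right j).ae_zero (by linarith) ((H.deriv_right j).ae_zero (by linarith)
    (ae_restrict_of_ae_restrict_of_subset (right_subset_element hh.le j) hw))
  have hz : (x.2 j : ℝ → ℝ) =ᵐ[volume.restrict (element h j)] 0 := by
    have hU := (ae_restrict_union_iff _ _ _).2 ⟨hl, hr⟩
    exact ae_restrict_of_ae_restrict_of_subset (element_eq_union hh.le j).subset hU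
  exact hz.trans (Lp.coeFn_zero ℝ 2 _).symm

/-- The operator `𝓛_γ : D(𝓛_γ) ⊆ ∏ⱼ L²(I_j) → ∏ⱼ L²(I_j)`, `𝓛_γ u = (∂²u_j/∂x²)`; the decoupled
operator `𝓛_0` is the case `γ = 0`. -/
def coupledOperator (M : ℕ) [NeZero M] (h : ℝ) (hh : 0 < h) (γ : ℝ) :
    StateSpace M h →ₗ.[ℝ] StateSpace M h :=
  (coupledGraph M h hh γ).toLinearPMap

theorem graph_coupledOperator (M : ℕ) [NeZero M] (h : ℝ) (hh : 0 < h) (γ : ℝ) :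
    (coupledOperator M h hh γ).graph = coupledGraph M h hh γ :=
  Submodule.toLinearPMap_graph_eq _ (coupledGraph_functional M h hh γ)

/-- The eigenspace `{u ∈ D(A) | A u = μ u}` of an unbounded operator `A`. -/
def opEigenspace {E : Type*} [AddCommGroup E] [Module ℝ E] (A : E →ₗ.[ℝ] E) (μ : ℝ) :
    Submodule ℝ E :=
  A.graph.comap (LinearMap.id.prod (μ • LinearMap.id))

theorem mem_opEigenspace {E : Type*} [AddCommGroup E] [Module ℝ E] (A : E →ₗ.[ℝ] E) (μ : ℝ)
    (u : E) : u ∈ opEigenspace A μ ↔ ∃ hu : u ∈ A.domain, A ⟨u, hu⟩ = μ • u := by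
  simp only [opEigenspace, Submodule.mem_comap, LinearPMap.mem_graph_iff]
  constructor
  · rintro ⟨⟨y, hy⟩, h1, h2⟩
    cases h1
    exact ⟨hy, h2⟩
  · rintro ⟨hu, h⟩
    exact ⟨⟨u, hu⟩, rfl, h⟩

/-- `lam 0 ≤ lam 1 ≤ …` and `e 0, e 1, …` are the eigenvalues of `-A`, repeated according to
multiplicity, and a complete orthonormal system of eigenvectors: `A (e n) = - lam n • e n`. -/
structure IsOrderedEigenbasis {E : Type*} [NormedAddCommGroup E] [InnerProductSpace ℝ E]
    (A : E →ₗ.[ℝ] E) (lam : ℕ → ℝ) (e : ℕ → E) : Prop where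
  mono : Monotone lam
  orthonormal : Orthonormal ℝ e
  complete : (Submodule.span ℝ (range e)).topologicalClosure = ⊤
  eigen : ∀ n, e n ∈ opEigenspace A (-lam n)

/-- Mosco convergence of a sequence of subsets of a Hilbert space: every point of `K₀` is a strong
limit of points of `K n`, and every weak limit of points of a subsequence of `K` is in `K₀`. -/
def MoscoConverges {E : Type*} [NormedAddCommGroup E] [InnerProductSpace ℝ E]
    (K : ℕ → Set E) (K₀ : Set E) : Prop :=
  (∀ u ∈ K₀, ∃ v : ℕ → E, (∀ n, v n ∈ K n) ∧ Tendsto v atTop (𝓝 u)) ∧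
  ∀ φ : ℕ → ℕ, StrictMono φ → ∀ v : ℕ → E, (∀ n, v n ∈ K (φ n)) → ∀ u : E,
    (∀ y : E, Tendsto (fun n => inner ℝ (v n) y) atTop (𝓝 (inner ℝ u y))) → u ∈ K₀

/-- The value `k²π²/h²`. -/
def limitEigenvalue (h : ℝ) (k : ℕ) : ℝ := (k : ℝ) ^ 2 * Real.pi ^ 2 / h ^ 2

/-- The eigenspace of `𝓛_0` for the eigenvalue `-k²π²/h²`. -/
def limitEigenspace (M : ℕ) [NeZero M] (h : ℝ) (hh : 0 < h) (k : ℕ) :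
    Submodule ℝ (StateSpace M h) :=
  opEigenspace (coupledOperator M h hh 0) (-limitEigenvalue h k)

/-- The multiplicity `m_k` of the eigenvalue `k²π²/h²` of `-𝓛_0`. -/
def mult (M : ℕ) [NeZero M] (h : ℝ) (hh : 0 < h) (k : ℕ) : ℕ :=
  Module.finrank ℝ (limitEigenspace M h hh k)

/-- The index `m_0 + ⋯ + m_{k-1}` at which the `k`-th group of eigenvalues starts. -/
def groupStart (M : ℕ) [NeZero M] (h : ℝ) (hh : 0 < h) (k : ℕ) : ℕ :=
  ∑ i ∈ Finset.range k, mult M h hh i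

/-- The span of the `k`-th group of `m_k` members of the sequence `e`. -/
def groupSpan (M : ℕ) [NeZero M] (h : ℝ) (hh : 0 < h) (e : ℕ → StateSpace M h) (k : ℕ) :
    Submodule ℝ (StateSpace M h) :=
  Submodule.span ℝ (range fun i : Fin (mult M h hh k) => e (groupStart M h hh k + i))

end CoupledElements

end

/-! The domain of 𝓛_γ changes with γ, so the operators are compared through their resolvents.
Integrating by parts on every half-element, the value conditions and the flux condition turn out to
be adjoint to each other, so -𝓛_γ is symmetric and nonnegative (`IsCoupledRep.inner_eq`). A solution
of s u - u'' = f is fixed on each element by three numbers, the value and the two one-sided slopes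
at the centre. The coupling conditions are a square linear system for these numbers, affine in γ,
and the energy identity makes it injective. Hence for one s > 0, the same for all γ, the resolvents
T_γ = (s - 𝓛_γ)⁻¹ exist, are compact, and are norm continuous in γ up to γ = 0 (`exists_resolvent`).

An eigenvalue λ of -𝓛_γ becomes the eigenvalue (s + λ)⁻¹ of T_γ with the same eigenvectors and the
order reversed, so Weyl's inequality (`IsSpectralSeq.abs_sub_le`) gives convergence of the n-th
eigenvalue for each n. The limit spectrum is found by solving w'' = -ω²w on the half-elements. The
multiplicities m_k are never computed: an eigenbasis of the decoupled operator is counted against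
the dimensions of its eigenspaces, which places the value λ_k exactly on the k-th group
(`eq_limitEigenvalue`).

For Mosco convergence put c = (s + λ_k)⁻¹. If u ∈ E_k, then T_γ u - c u = (T_γ - T_0)u is small,
while the eigenvalues of T_γ outside the group keep a fixed distance from c, so u is close to its
projection onto the group. Conversely, members of the group's span are approximate eigenvectors for
c, and this property survives weak limits because T_γ → T_0 in norm and T_0 is symmetric
(`moscoConverges_span`). -/

namespace CoupledElements

/-! ### Spectral sequences of compact positive operators -/

/-- A real function on an infinite type with finite sublevel sets can be listed monotonically. -/
theorem exists_equiv_nat_monotone {ι : Type*} [Infinite ι] (f : ι → ℝ)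
    (hf : ∀ c, {i | f i ≤ c}.Finite) : ∃ g : ℕ ≃ ι, Monotone (f ∘ g) := by
  classical
  have hc : Countable ι := by
    have : (⋃ n : ℕ, {i | f i ≤ n}) = univ := by
      refine eq_univ_of_forall fun i => mem_iUnion.2 ?_
      obtain ⟨n, hn⟩ := exists_nat_ge (f i)
      exact ⟨n, hn⟩
    rw [← countable_univ_iff, ← this]
    exact countable_iUnion fun n => (hf n).countable
  obtain ⟨enc, henc⟩ := exists_injective_nat ι
  -- Ties of `f` are broken by an injection into ℕ. This gives a linear order with finite initial
  -- segments and no maximum, hence one of type ℕ.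
  let key : ι → ℝ ×ₗ ℕ := fun i => toLex (f i, enc i)
  have hkey : Function.Injective key := fun i j hij => henc (by
    have := congrArg (fun x => (ofLex x).2) hij
    simpa [key] using this)
  let _ : LinearOrder ι := LinearOrder.lift' key hkey
  have hle : ∀ {i j : ι}, i ≤ j → f i ≤ f j := fun {i j} hij => by
    have h1 : key i ≤ key j := hij
    rw [Prod.Lex.le_iff] at h1
    rcases h1 with h1 | h1
    · exact h1.le
    · exact h1.1.le
  have hfin : ∀ i : ι, (Iic i).Finite := fun i => (hf (f i)).subset fun j hj => hle hj
  let _ : LocallyFiniteOrder ι :=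
    LocallyFiniteOrder.ofFiniteIcc fun a b => (hfin b).subset Icc_subset_Iic_self
  have : NoMaxOrder ι := ⟨fun a => by
    by_contra! hcon
    exact infinite_univ ((hfin a).subset fun x _ => hcon x)⟩
  obtain ⟨b, hb⟩ : ∃ b : ι, ∀ a, b ≤ a := by
    obtain ⟨i⟩ : Nonempty ι := inferInstance
    obtain ⟨b, hb⟩ := (hfin i).exists_minimal ⟨i, mem_Iic.2 le_rfl⟩
    refine ⟨b, fun a => ?_⟩
    rcases le_total a b with h | h
    · exact hb.2 (h.trans hb.1) h
    · exact h
  let _ : OrderBot ι := { bot := b, bot_le := hb }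
  let _ : SuccOrder ι := LinearLocallyFiniteOrder.succOrder ι
  let _ : PredOrder ι := LinearLocallyFiniteOrder.predOrder ι
  let o : ι ≃o ℕ := orderIsoNatOfLinearSuccPredArch
  exact ⟨o.symm.toEquiv, fun m n hmn => hle (o.symm.monotone hmn)⟩

variable {E : Type*} [NormedAddCommGroup E] [InnerProductSpace ℝ E]

/-- `μ 0 ≥ μ 1 ≥ …` are the eigenvalues of the bounded operator `T`, repeated according to
multiplicity, and `e` is a corresponding complete orthonormal system of eigenvectors. -/
structure IsSpectralSeq (T : E →L[ℝ] E) (μ : ℕ → ℝ) (e : ℕ → E) : Prop where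
  anti : Antitone μ
  orthonormal : Orthonormal ℝ e
  complete : (Submodule.span ℝ (range e)).topologicalClosure = ⊤
  apply : ∀ n, T (e n) = μ n • e n

/-- The eigenvalues of a compact operator along an orthonormal family of eigenvectors do not
accumulate away from zero. -/
theorem finite_setOf_le_eigenvalue {ι : Type*} {T : E →L[ℝ] E} (hT : IsCompactOperator T)
    {v : ι → E} (hv : Orthonormal ℝ v) {μ : ι → ℝ} (hμ : ∀ i, T (v i) = μ i • v i) {ε : ℝ}
    (hε : 0 < ε) : {i | ε ≤ μ i}.Finite := by
  by_contra hinf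
  have hinf' : {i | ε ≤ μ i}.Infinite := hinf
  let g := hinf'.natEmbedding
  obtain ⟨K, hK, hKT⟩ := hT.image_closedBall_subset_compact (f := (T : E →ₗ[ℝ] E)) 1
  have hmem : ∀ n, T (v (g n)) ∈ K := fun n => hKT ⟨v (g n), by simp [hv.1], rfl⟩
  obtain ⟨a, -, φ, hφ, hlim⟩ := hK.tendsto_subseq hmem
  have hcauchy := hlim.cauchySeq
  rw [Metric.cauchySeq_iff'] at hcauchy
  obtain ⟨N, hN⟩ := hcauchy ε hε
  have h1 := hN (N + 1) (by omega)
  have hne : (g (φ (N + 1)) : ι) ≠ g (φ N) := fun hcon => by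
    have := hφ.injective (g.injective (Subtype.ext hcon))
    omega
  set i := (g (φ (N + 1)) : ι) with hi
  have hiε : ε ≤ μ i := (g (φ (N + 1))).2
  simp only [Function.comp] at h1
  rw [hμ, hμ, dist_eq_norm] at h1
  -- By orthogonality, the images of two distinct eigenvectors are at least `ε` apart, so no
  -- subsequence of the images is Cauchy.
  have h2 : inner ℝ (v i) (μ i • v i - μ (g (φ N)) • v (g (φ N))) = μ i := by
    rw [inner_sub_right, inner_smul_right, inner_smul_right, hv.2 hne,
      real_inner_self_eq_norm_sq, hv.1]
    simp
  have h3 := real_inner_le_norm (v i) (μ i • v i - μ (g (φ N)) • v (g (φ N)))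
  rw [h2, hv.1, one_mul] at h3
  linarith

/-- A compact positive definite operator on an infinite-dimensional Hilbert space has a spectral
sequence, and its eigenvalues are positive. -/
theorem exists_isSpectralSeq [CompleteSpace E] {T : E →L[ℝ] E} (hT : IsCompactOperator T)
    (hsym : T.IsSymmetric) (hpos : ∀ x, x ≠ 0 → 0 < inner ℝ (T x) x)
    (hinf : ¬ FiniteDimensional ℝ E) :
    ∃ μ e, IsSpectralSeq T μ e ∧ ∀ n, 0 < μ n := by
  classical
  have h0 : Module.End.eigenspace (T : E →ₗ[ℝ] E) 0 = ⊥ := by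
    rw [Submodule.eq_bot_iff]
    intro x hx
    rw [Module.End.mem_eigenspace_iff] at hx
    by_contra hne
    have := hpos x hne
    have hx' : T x = 0 := by simpa using hx
    simp [hx'] at this
  have hfd : ∀ μ : ℝ, FiniteDimensional ℝ (Module.End.eigenspace (T : E →ₗ[ℝ] E) μ) := fun μ => by
    by_cases hμ : μ = 0
    · rw [hμ, h0]
      infer_instance
    · exact ContinuousLinearMap.finite_dimensional_eigenspace hT μ hμ
  let b := fun μ : ℝ => stdOrthonormalBasis ℝ (Module.End.eigenspace (T : E →ₗ[ℝ] E) μ)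
  let ι := Σ μ : ℝ, Fin (Module.finrank ℝ (Module.End.eigenspace (T : E →ₗ[ℝ] E) μ))
  let v : ι → E := fun i => (b i.1 i.2 : E)
  have hv : Orthonormal ℝ v :=
    hsym.orthogonalFamily_eigenspaces.orthonormal_sigma_orthonormal
      (v_family := fun μ => b μ) fun μ => (b μ).orthonormal
  have hTv : ∀ i, T (v i) = i.1 • v i := fun i =>
    Module.End.mem_eigenspace_iff.1 (b i.1 i.2).2
  have hpos' : ∀ i : ι, 0 < i.1 := fun i => by
    have hne : v i ≠ 0 := hv.ne_zero i
    have := hpos _ hne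
    rw [hTv, inner_smul_left, real_inner_self_eq_norm_sq, hv.1] at this
    simpa using this
  have hspan : Submodule.span ℝ (range v) = ⨆ μ, Module.End.eigenspace (T : E →ₗ[ℝ] E) μ := by
    refine le_antisymm (Submodule.span_le.2 ?_) (iSup_le fun μ => ?_)
    · rintro _ ⟨i, rfl⟩
      exact Submodule.mem_iSup_of_mem i.1 (b i.1 i.2).2
    · intro x hx
      have h1 := (b μ).sum_repr ⟨x, hx⟩
      have h2 := congrArg (Submodule.subtype _) h1
      rw [map_sum] at h2
      change _ = x at h2
      rw [← h2]
      refine Submodule.sum_mem _ fun k _ => ?_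
      rw [map_smul]
      exact Submodule.smul_mem _ _ (Submodule.subset_span ⟨⟨μ, k⟩, rfl⟩)
  have horth : (Submodule.span ℝ (range v))ᗮ = ⊥ := by
    rw [hspan]
    exact ContinuousLinearMap.orthogonalComplement_iSup_eigenspaces_eq_bot hT hsym
  have hcomp : (Submodule.span ℝ (range v)).topologicalClosure = ⊤ := by
    rw [← Submodule.orthogonal_orthogonal_eq_closure, horth, Submodule.bot_orthogonal_eq_top]
  have : Infinite ι := by
    by_contra hni
    have : Finite ι := not_infinite_iff_finite.1 hni
    apply hinf
    have hf : FiniteDimensional ℝ (Submodule.span ℝ (range v)) :=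
      FiniteDimensional.span_of_finite ℝ (finite_range v)
    have htop : Submodule.span ℝ (range v) = ⊤ := by
      rw [← hcomp]
      exact (Submodule.closed_of_finiteDimensional _).submodule_topologicalClosure_eq.symm
    rw [htop] at hf
    exact Module.Finite.equiv (Submodule.topEquiv (R := ℝ) (M := E))
  have hsub : ∀ c : ℝ, {i : ι | (i.1)⁻¹ ≤ c}.Finite := fun c => by
    -- The maximum with 1 keeps the threshold positive when `c ≤ 0`.
    refine (finite_setOf_le_eigenvalue hT hv hTv (ε := (max c 1)⁻¹) (by positivity)).subset ?_
    intro i hi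
    have : (i.1)⁻¹ ≤ max c 1 := le_trans hi (le_max_left _ _)
    exact inv_le_of_inv_le₀ (hpos' i) this
  obtain ⟨g, hg⟩ := exists_equiv_nat_monotone (fun i : ι => (i.1)⁻¹) hsub
  refine ⟨fun n => (g n).1, v ∘ g, ⟨fun m n hmn => ?_, hv.comp _ g.injective, ?_, fun n => hTv _⟩,
    fun n => hpos' _⟩
  · exact (inv_le_inv₀ (hpos' _) (hpos' _)).1 (hg hmn)
  · rw [range_comp, g.surjective.range_eq, image_univ, hcomp]

namespace IsSpectralSeq

variable {T S : E →L[ℝ] E} {μ ν : ℕ → ℝ} {e f : ℕ → E}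

theorem hasSum_inner [CompleteSpace E] (H : IsSpectralSeq T μ e) (x y : E) :
    HasSum (fun i => inner ℝ x (e i) * inner ℝ (e i) y) (inner ℝ x y) := by
  have := (HilbertBasis.mk H.orthonormal H.complete.ge).hasSum_inner_mul_inner x y
  simpa only [HilbertBasis.coe_mk] using this

theorem inner_apply (H : IsSpectralSeq T μ e) (hsym : T.IsSymmetric) (n : ℕ) (x : E) :
    inner ℝ (e n) (T x) = μ n * inner ℝ (e n) x := by
  have h1 := hsym (e n) x
  simp only [ContinuousLinearMap.coe_coe] at h1
  rw [← h1, H.apply, real_inner_smul_left]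

/-- One half of Weyl's inequality. -/
theorem le_add_norm_sub [CompleteSpace E] (H : IsSpectralSeq T μ e) (K : IsSpectralSeq S ν f)
    (hS : S.IsSymmetric) (n : ℕ) : μ n ≤ ν n + ‖T - S‖ := by
  -- Min-max by counting dimensions: `n + 1` coefficients against `n` conditions leave a nonzero `x`
  -- in the span of `e 0, …, e n` that is orthogonal to `f 0, …, f (n - 1)`. Its Rayleigh quotient
  -- is at least `μ n` for `T` and at most `ν n` for `S`.
  let F : (Fin (n + 1) → ℝ) →ₗ[ℝ] (Fin n → ℝ) :=
    LinearMap.pi fun j => ((innerSL ℝ (f j) : E →L[ℝ] ℝ) : E →ₗ[ℝ] ℝ) ∘ₗ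
      Fintype.linearCombination ℝ (fun i : Fin (n + 1) => e i)
  have hker : LinearMap.ker F ≠ ⊥ := F.ker_ne_bot_of_finrank_lt (by simp)
  obtain ⟨c, hc, hc0⟩ := Submodule.exists_mem_ne_zero_of_ne_bot hker
  set x : E := ∑ i : Fin (n + 1), c i • e i with hx
  have hFx : ∀ j < n, inner ℝ (f j) x = 0 := fun j hj => by
    have := congrFun (LinearMap.mem_ker.1 hc) ⟨j, hj⟩
    simpa [F, Fintype.linearCombination_apply, hx] using this
  have hon : Orthonormal ℝ (fun i : Fin (n + 1) => e i) :=
    H.orthonormal.comp _ Fin.val_injective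
  have hxx : ‖x‖ ^ 2 = ∑ i, c i * c i := by
    rw [← real_inner_self_eq_norm_sq, hx, hon.inner_sum]
    simp
  have hx0 : 0 < ‖x‖ ^ 2 := by
    rw [hxx]
    obtain ⟨i, hi⟩ := Function.ne_iff.1 hc0
    exact Finset.sum_pos' (fun i _ => mul_self_nonneg _)
      ⟨i, Finset.mem_univ _, mul_self_pos.2 hi⟩
  have hTx : μ n * ‖x‖ ^ 2 ≤ inner ℝ (T x) x := by
    have h1 : T x = ∑ i : Fin (n + 1), (c i * μ i) • e i := by
      rw [hx, map_sum]
      simp only [map_smul, H.apply, smul_smul]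
    rw [h1, hx, hon.inner_sum, ← hx, hxx, Finset.mul_sum]
    refine Finset.sum_le_sum fun i _ => ?_
    have := H.anti (Nat.lt_succ_iff.1 i.2)
    simp only [conj_trivial]
    nlinarith [mul_self_nonneg (c i)]
  have hSx : inner ℝ (S x) x ≤ ν n * ‖x‖ ^ 2 := by
    rw [real_inner_comm, ← real_inner_self_eq_norm_sq]
    refine hasSum_le (fun i => ?_) (K.hasSum_inner x (S x)) ((K.hasSum_inner x x).mul_left (ν n))
    rw [K.inner_apply hS, real_inner_comm]
    rcases lt_or_ge i n with hi | hi
    · simp [hFx i hi]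
    · have := K.anti hi
      nlinarith [mul_self_nonneg (inner ℝ (f i) x)]
  have hTS : inner ℝ (T x) x - inner ℝ (S x) x ≤ ‖T - S‖ * ‖x‖ ^ 2 := by
    rw [← inner_sub_left]
    have h1 := real_inner_le_norm (T x - S x) x
    have h2 := (T - S).le_opNorm x
    rw [_root_.sub_apply] at h2
    nlinarith [norm_nonneg x]
  have : μ n * ‖x‖ ^ 2 ≤ (ν n + ‖T - S‖) * ‖x‖ ^ 2 := by linarith
  exact le_of_mul_le_mul_right this hx0

/-- **Weyl's inequality** for the ordered eigenvalues of two operators. -/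
theorem abs_sub_le [CompleteSpace E] (H : IsSpectralSeq T μ e) (K : IsSpectralSeq S ν f)
    (hT : T.IsSymmetric) (hS : S.IsSymmetric) (n : ℕ) : |μ n - ν n| ≤ ‖T - S‖ := by
  have h1 := H.le_add_norm_sub K hS n
  have h2 := K.le_add_norm_sub H hT n
  rw [norm_sub_rev] at h2
  rw [abs_le]
  constructor <;> linarith

/-- The distance of `x` to the span of a finite set of eigenvectors is controlled by the residual
of `x` if the remaining eigenvalues are bounded away from `c`. -/
theorem mul_norm_sub_sum_le [CompleteSpace E] (H : IsSpectralSeq T μ e) (hT : T.IsSymmetric)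
    (s : Finset ℕ) {c δ : ℝ} (hδ : 0 ≤ δ) (hs : ∀ i ∉ s, δ ≤ |μ i - c|) (x : E) :
    δ * ‖x - ∑ i ∈ s, (inner ℝ (e i) x : ℝ) • e i‖ ≤ ‖T x - c • x‖ := by
  classical
  set y := x - ∑ i ∈ s, (inner ℝ (e i) x : ℝ) • e i with hy
  have hey : ∀ i, inner ℝ (e i) y = if i ∈ s then 0 else inner ℝ (e i) x := fun i => by
    rw [hy, inner_sub_right, inner_sum]
    simp only [inner_smul_right, orthonormal_iff_ite.1 H.orthonormal]
    split_ifs with hi <;> simp [hi]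
  have hsq : δ ^ 2 * ‖y‖ ^ 2 ≤ ‖T x - c • x‖ ^ 2 := by
    rw [← real_inner_self_eq_norm_sq, ← real_inner_self_eq_norm_sq]
    refine hasSum_le (fun i => ?_) ((H.hasSum_inner y y).mul_left (δ ^ 2))
      (H.hasSum_inner (T x - c • x) (T x - c • x))
    rw [real_inner_comm (e i) y, real_inner_comm (e i) (T x - c • x), hey, inner_sub_right,
      H.inner_apply hT, inner_smul_right]
    split_ifs with hi
    · nlinarith [mul_self_nonneg (μ i * inner ℝ (e i) x - c * inner ℝ (e i) x)]
    · have h1 : δ ^ 2 ≤ (μ i - c) ^ 2 := by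
        rw [← sq_abs (μ i - c)]
        exact pow_le_pow_left₀ hδ (hs i hi) 2
      nlinarith [mul_le_mul_of_nonneg_right h1 (mul_self_nonneg (inner ℝ (e i) x))]
  refine le_of_sq_le_sq ?_ (norm_nonneg _)
  rw [mul_pow]
  exact hsq

/-- The dimension of an eigenspace counts the corresponding members of the spectral sequence. -/
theorem ncard_eq_finrank [CompleteSpace E] (H : IsSpectralSeq T μ e) (hT : T.IsSymmetric) (c : ℝ)
    [FiniteDimensional ℝ (Module.End.eigenspace (T : E →ₗ[ℝ] E) c)] :
    {n | μ n = c}.Finite ∧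
      {n | μ n = c}.ncard = Module.finrank ℝ (Module.End.eigenspace (T : E →ₗ[ℝ] E) c) := by
  classical
  set W := Module.End.eigenspace (T : E →ₗ[ℝ] E) c with hW
  have hmem : ∀ n : {n | μ n = c}, e n ∈ W := fun n => by
    rw [hW, Module.End.mem_eigenspace_iff]
    have h1 := H.apply n
    rw [n.2] at h1
    exact h1
  let g : {n | μ n = c} → W := fun n => ⟨e n, hmem n⟩
  have hli : LinearIndependent ℝ g := by
    have h1 : LinearIndependent ℝ (fun n : {n | μ n = c} => e n) :=
      (H.orthonormal.comp _ Subtype.val_injective).linearIndependent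
    exact LinearIndependent.of_comp W.subtype h1
  -- Independent vectors in a finite-dimensional space are finitely many. Finiteness is needed
  -- separately, since `ncard` is 0 on infinite sets.
  have hfin : Finite {n | μ n = c} := hli.finite
  have hsetfin : {n | μ n = c}.Finite := hfin
  refine ⟨hsetfin, ?_⟩
  have : Fintype {n | μ n = c} := Fintype.ofFinite _
  have hspan : ⊤ ≤ Submodule.span ℝ (range g) := by
    rintro ⟨x, hx⟩ -
    have hxT : T x = c • x := Module.End.mem_eigenspace_iff.1 hx
    have hxe : ∀ n ∉ hsetfin.toFinset, inner ℝ (e n) x = 0 := fun n hn => by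
      have h1 := H.inner_apply hT n x
      rw [hxT, inner_smul_right] at h1
      have h2 : μ n ≠ c := fun hcon => hn (hsetfin.mem_toFinset.2 hcon)
      have h3 : (μ n - c) * inner ℝ (e n) x = 0 := by linarith
      exact (mul_eq_zero.1 h3).resolve_left (sub_ne_zero.2 h2)
    have hxs : x = ∑ i ∈ hsetfin.toFinset, (inner ℝ (e i) x : ℝ) • e i := by
      rw [← sub_eq_zero, ← norm_eq_zero, ← sq_eq_zero_iff, ← real_inner_self_eq_norm_sq]
      refine (H.hasSum_inner _ _).unique ?_
      convert hasSum_zero with i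
      refine mul_eq_zero_of_right _ ?_
      rw [inner_sub_right, inner_sum]
      simp only [inner_smul_right, orthonormal_iff_ite.1 H.orthonormal]
      by_cases hi : i ∈ hsetfin.toFinset
      · rw [Finset.sum_eq_single_of_mem i hi fun j _ hj => by simp [hj.symm]]
        simp
      · rw [hxe i hi, Finset.sum_eq_zero, sub_zero]
        intro j hj
        have : i ≠ j := fun hcon => hi (hcon ▸ hj)
        simp [this]
    have : (⟨x, hx⟩ : W) = ∑ i : {n | μ n = c}, (inner ℝ (e i) x : ℝ) • g i := by
      apply Subtype.ext
      rw [Submodule.coe_sum]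
      simp only [Submodule.coe_smul, g]
      conv_lhs => rw [hxs]
      exact Finset.sum_subtype _ (fun n => by simp) _
    rw [this]
    exact Submodule.sum_mem _ fun i _ => Submodule.smul_mem _ _ (Submodule.subset_span ⟨i, rfl⟩)
  rw [Module.finrank_eq_card_basis (Module.Basis.mk hli hspan), ← Nat.card_coe_set_eq,
    Nat.card_eq_fintype_card]

end IsSpectralSeq

/-- Weak limits of approximate eigenvectors of norm-convergent symmetric operators are
eigenvectors of the limit. -/
theorem apply_eq_smul_of_weak_limit [CompleteSpace E] {T : ℕ → E →L[ℝ] E} {T₀ : E →L[ℝ] E}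
    (hT₀ : T₀.IsSymmetric) (hlim : Tendsto T atTop (𝓝 T₀)) {c : ℝ}
    {v : ℕ → E} {u : E} {d : ℕ → ℝ} (hd : Tendsto d atTop (𝓝 0))
    (hv : ∀ n, ‖T n (v n) - c • v n‖ ≤ d n * ‖v n‖)
    (hu : ∀ y, Tendsto (fun n => inner ℝ (v n) y) atTop (𝓝 (inner ℝ u y))) :
    T₀ u = c • u := by
  -- Weakly convergent sequences are bounded, by uniform boundedness applied to the functionals ⟪v
  -- n, ·⟫.
  obtain ⟨C, hC⟩ : ∃ C, ∀ n, ‖v n‖ ≤ C := by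
    have h1 : ∃ C, ∀ n, ‖innerSL ℝ (v n)‖ ≤ C := by
      refine banach_steinhaus fun y => ?_
      obtain ⟨C, hC⟩ := (hu y).norm.bddAbove_range
      exact ⟨C, fun n => by simpa using hC ⟨n, rfl⟩⟩
    simpa using h1
  have hTn : Tendsto (fun n => ‖T n - T₀‖) atTop (𝓝 0) := tendsto_iff_norm_sub_tendsto_zero.1 hlim
  have hz : ∀ g : ℕ → ℝ, Tendsto g atTop (𝓝 0) → Tendsto (fun n => |g n| * C) atTop (𝓝 0) :=
    fun g hg => by simpa using hg.abs.mul_const C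
  refine ext_inner_right ℝ fun y => ?_
  have h1 : Tendsto (fun n => inner ℝ (v n) (T₀ y)) atTop (𝓝 (inner ℝ (T₀ u) y)) := by
    have h2 := hT₀ u y
    simp only [ContinuousLinearMap.coe_coe] at h2
    rw [h2]
    exact hu _
  have h3 : Tendsto (fun n => inner ℝ (c • v n) y) atTop (𝓝 (inner ℝ (c • u) y)) := by
    simp only [inner_smul_left]
    exact (hu y).const_mul _
  have h4 : Tendsto (fun n => (inner ℝ (v n) (T₀ y) - inner ℝ (c • v n) y : ℝ)) atTop (𝓝 0) := by
    refine squeeze_zero_norm (a := fun n => (|‖T n - T₀‖| * C + |d n| * C) * ‖y‖) (fun n => ?_) ?_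
    -- Symmetry moves `T₀` onto `v n`. What remains is the residual of `v n` for `T n` and the
    -- operator difference, both tending to 0 on bounded sequences.
    · have h5 : (inner ℝ (v n) (T₀ y) - inner ℝ (c • v n) y : ℝ)
          = inner ℝ ((T n (v n) - c • v n) - (T n - T₀) (v n)) y := by
        have h2 := hT₀ (v n) y
        simp only [ContinuousLinearMap.coe_coe] at h2
        rw [← h2, ← inner_sub_left]
        congr 1
        rw [_root_.sub_apply]
        abel
      rw [h5]
      refine (norm_inner_le_norm _ _).trans ?_
      refine mul_le_mul_of_nonneg_right ?_ (norm_nonneg _)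
      refine (norm_sub_le _ _).trans ?_
      rw [add_comm]
      refine add_le_add ?_ ?_
      · rw [abs_norm]
        exact ((T n - T₀).le_opNorm _).trans (mul_le_mul_of_nonneg_left (hC n) (norm_nonneg _))
      · refine (hv n).trans ?_
        exact mul_le_mul (le_abs_self _) (hC n) (norm_nonneg _) (abs_nonneg _)
    · simpa using ((hz _ hTn).add (hz _ hd)).mul_const ‖y‖
  have h6 := tendsto_nhds_unique (h1.sub h3) h4
  linarith

end CoupledElements

namespace CoupledElements

/-! ### Integration by parts in `H¹` -/

/-- The product rule for absolutely continuous functions is applied to the primitives, not to `w`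
and `w'`, which are unrestricted outside `[a, b]`. -/
theorem IsH1Deriv.integral_mul_add_mul {a b : ℝ} (hab : a ≤ b) {w p w' p' : ℝ → ℝ}
    (H : IsH1Deriv a b w p) (H' : IsH1Deriv a b w' p') :
    ∫ x in a..b, (p x * w' x + w x * p' x) = w b * w' b - w a * w' a := by
  have hbI : b ∈ Icc a b := right_mem_Icc.2 hab
  have key : ∀ {w p : ℝ → ℝ}, IsH1Deriv a b w p →
      AbsolutelyContinuousOnInterval (fun x => w a + ∫ t in a..x, p t) a b ∧
      ∀ᵐ x, x ∈ uIoc a b → deriv (fun x => w a + ∫ t in a..x, p t) x = p x := by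
    intro w p H
    have hi := H.intervalIntegrable hbI
    refine ⟨AbsolutelyContinuousOnInterval.add ?_
      (hi.absolutelyContinuousOnInterval_intervalIntegral left_mem_uIcc), ?_⟩
    · exact (LipschitzWith.const (w a)).lipschitzOnWith.absolutelyContinuousOnInterval
    · filter_upwards [hi.ae_hasDerivAt_integral] with x hx hxI
      exact ((hx (uIoc_subset_uIcc hxI) a left_mem_uIcc).const_add (w a)).deriv
  obtain ⟨hac, hd⟩ := key H
  obtain ⟨hac', hd'⟩ := key H'
  have h1 := hac.integral_deriv_mul_eq_sub hac'
  rw [← H.2 b hbI, ← H'.2 b hbI] at h1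
  simp only [intervalIntegral.integral_same, add_zero] at h1
  rw [← h1]
  refine intervalIntegral.integral_congr_ae ?_
  filter_upwards [hd, hd'] with x hx hx' hxI
  have hxI' : x ∈ Icc a b := by
    rw [uIoc_of_le hab] at hxI
    exact Ioc_subset_Icc_self hxI
  rw [hx hxI, hx' hxI, ← H.2 x hxI', ← H'.2 x hxI']

theorem IsH1Deriv.integral_mul {a b : ℝ} (hab : a ≤ b) {w p w' p' : ℝ → ℝ}
    (H : IsH1Deriv a b w p) (H' : IsH1Deriv a b w' p') :
    ∫ x in a..b, p x * w' x = w b * w' b - w a * w' a - ∫ x in a..b, w x * p' x := by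
  have hbI : b ∈ Icc a b := right_mem_Icc.2 hab
  rw [← H.integral_mul_add_mul hab H', intervalIntegral.integral_add, add_sub_cancel_right]
  · exact (H.intervalIntegrable hbI).mul_continuousOn
      (by rw [uIcc_of_le hab]; exact H'.continuousOn hab)
  · exact (H'.intervalIntegrable hbI).continuousOn_mul
      (by rw [uIcc_of_le hab]; exact H.continuousOn hab)

/-- A primitive with an arbitrary base point is in `H¹`. -/
theorem isH1Deriv_of_primitive {a b X A : ℝ} {w p : ℝ → ℝ} (hX : X ∈ Icc a b)
    (hp : MemLp p 2 (volume.restrict (Icc a b)))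
    (hw : ∀ x ∈ Icc a b, w x = A + ∫ t in X..x, p t) : IsH1Deriv a b w p := by
  refine ⟨hp, fun x hx => ?_⟩
  have hint : ∀ c ∈ Icc a b, ∀ d ∈ Icc a b, IntervalIntegrable p volume c d := by
    intro c hc d hd
    have h1 : IntegrableOn p (Icc a b) volume := hp.integrable (by norm_num)
    refine (h1.mono_set ?_).intervalIntegrable
    exact uIcc_subset_Icc hc hd
  have ha : a ∈ Icc a b := left_mem_Icc.2 (hX.1.trans hX.2)
  rw [hw x hx, hw a ha, add_assoc, intervalIntegral.integral_add_adjacent_intervals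
    (hint X hX a ha) (hint a ha x hx)]

/-! ### The primitive as a compact operator on `L²` -/

section Kernel

variable {α : Type*} [MeasurableSpace α] {ν : Measure α}
variable {F : Type*} [NormedAddCommGroup F] [InnerProductSpace ℝ F]

/-- The real inner product as a continuous bilinear map. -/
noncomputable def innerBilin (F : Type*) [NormedAddCommGroup F] [InnerProductSpace ℝ F] :
    F →L[ℝ] F →L[ℝ] ℝ :=
  (isBoundedBilinearMap_inner (𝕜 := ℝ) (E := F)).toContinuousLinearMap

theorem innerBilin_apply (x y : F) : innerBilin F x y = inner ℝ x y := rfl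

/-- The operator `f ↦ (x ↦ ⟪f, κ x⟫)` with an `L²` kernel `κ`. -/
noncomputable def kernelOperator (κ : Lp F 2 ν) : F →L[ℝ] Lp ℝ 2 ν :=
  ((innerBilin F).compLpL₂ 2 ν).flip κ

theorem coeFn_kernelOperator (κ : Lp F 2 ν) (f : F) :
    kernelOperator κ f =ᵐ[ν] fun x => inner ℝ f (κ x) :=
  ContinuousLinearMap.coeFn_compLp _ _

/-- The kernel 1_s · c gives a rank-one operator. Sums of compact operators are compact, and κ ↦
operator is continuous into a space where the compact operators are closed, so density of simple
functions suffices. -/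
theorem isCompactOperator_kernelOperator (κ : Lp F 2 ν) :
    IsCompactOperator (kernelOperator κ) := by
  refine Lp.induction (by norm_num) (fun κ => IsCompactOperator (kernelOperator κ)) ?_ ?_ ?_ κ
  · intro c s hs hνs
    have : kernelOperator (Lp.simpleFunc.indicatorConst 2 hs hνs.ne c : Lp F 2 ν) =
        (ContinuousLinearMap.toSpanSingleton ℝ (indicatorConstLp 2 hs hνs.ne (1 : ℝ))) ∘L
          ((innerBilin F).flip c) := by
      ext1 f
      refine Lp.ext ?_
      refine (coeFn_kernelOperator _ _).trans ?_
      rw [Lp.simpleFunc.coe_indicatorConst]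
      have e1 := indicatorConstLp_coeFn (p := 2) (hs := hs) (hμs := hνs.ne) (c := c)
      have e2 := indicatorConstLp_coeFn (p := 2) (hs := hs) (hμs := hνs.ne) (c := (1 : ℝ))
      have e3 := Lp.coeFn_smul (inner ℝ f c : ℝ) (indicatorConstLp 2 hs hνs.ne (1 : ℝ))
      filter_upwards [e1, e2, e3] with x h1 h2 h3
      rw [h1]
      simp only [ContinuousLinearMap.comp_apply, ContinuousLinearMap.toSpanSingleton_apply,
        ContinuousLinearMap.flip_apply, innerBilin_apply]
      rw [h3, Pi.smul_apply, h2]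
      by_cases hx : x ∈ s <;> simp [hx]
    rw [this]
    exact (isCompactOperator_of_locallyCompactSpace_rng
      (ContinuousLinearMap.toSpanSingleton ℝ (indicatorConstLp 2 hs hνs.ne (1 : ℝ)))).comp_clm _
  · intro f g hf hg _ h1 h2
    have : kernelOperator (hf.toLp f + hg.toLp g) =
        kernelOperator (hf.toLp f) + kernelOperator (hg.toLp g) := map_add _ _ _
    rw [this]
    exact h1.add h2
  · exact isClosed_setOfPred_isCompactOperator.preimage
      (((innerBilin F).compLpL₂ 2 ν).flip).continuous

end Kernel

section Primitive

variable (s : Set ℝ) [IsFiniteMeasure (volume.restrict s)]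

/-- The element of `L²(s)` representing `f ↦ ∫ t in X..x, f t`. -/
noncomputable def primitiveKernel (X x : ℝ) : Lp ℝ 2 (volume.restrict s) :=
  indicatorConstLp 2 measurableSet_Iic (measure_ne_top _ (Iic x)) 1 -
    indicatorConstLp 2 measurableSet_Iic (measure_ne_top _ (Iic X)) 1

theorem integrable_coeFn_Lp (f : Lp ℝ 2 (volume.restrict s)) : IntegrableOn f s :=
  (Lp.memLp f).integrable (by norm_num)

/-- The kernel is a difference of indicators of half-lines, so the sign of the oriented integral is
right on both sides of `X`. -/
theorem inner_primitiveKernel {X x : ℝ} (hs : uIcc X x ⊆ s) (f : Lp ℝ 2 (volume.restrict s)) :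
    inner ℝ (primitiveKernel s X x) f = ∫ t in X..x, f t := by
  rw [primitiveKernel, inner_sub_left, L2.inner_indicatorConstLp_one,
    L2.inner_indicatorConstLp_one, intervalIntegral.integral_Iic_sub_Iic
      (integrable_coeFn_Lp s f).integrableOn (integrable_coeFn_Lp s f).integrableOn]
  have h1 : ∀ {c d : ℝ}, uIcc c d ⊆ s →
      (volume.restrict s).restrict (Ioc c d) = volume.restrict (Ioc c d) := fun {c d} h => by
    rw [Measure.restrict_restrict measurableSet_Ioc, inter_eq_left.2]
    exact Ioc_subset_Icc_self.trans (Icc_subset_uIcc.trans h)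
  rw [intervalIntegral.intervalIntegral_eq_integral_uIoc,
    intervalIntegral.intervalIntegral_eq_integral_uIoc]
  rcases le_total X x with h | h
  · rw [uIoc_of_le h, h1 hs]
  · rw [uIoc_of_ge h, h1 (by rwa [uIcc_comm])]

/-- The half-lines ending at `x` and `y` differ by a set of measure at most |y - x|. Continuity
supplies the measurability needed to regard the kernel as an L² function of `x`. -/
theorem continuous_primitiveKernel (X : ℝ) : Continuous (primitiveKernel s X) := by
  refine Continuous.sub ?_ continuous_const
  refine continuous_indicatorConstLp_set (by norm_num) fun x => ?_
  have hb : ∀ y, (volume.restrict s) (symmDiff (Iic y) (Iic x)) ≤ ENNReal.ofReal |y - x| := by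
    intro y
    refine (Measure.restrict_apply_le _ _).trans ?_
    have : symmDiff (Iic y) (Iic x) ⊆ uIcc x y := by
      intro t ht
      rw [mem_symmDiff, mem_Iic, mem_Iic] at ht
      rw [mem_uIcc]
      rcases ht with ⟨h1, h2⟩ | ⟨h1, h2⟩
      · exact Or.inl ⟨(not_le.1 h2).le, h1⟩
      · exact Or.inr ⟨(not_le.1 h2).le, h1⟩
    refine (measure_mono this).trans ?_
    rw [Real.volume_interval]
  have h0 : Tendsto (fun y => ENNReal.ofReal |y - x|) (𝓝 x) (𝓝 0) := by
    have : Tendsto (fun y => |y - x|) (𝓝 x) (𝓝 0) := by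
      have h := ((continuous_id.sub continuous_const).abs : Continuous fun y : ℝ => |y - x|)
      simpa using h.tendsto x
    simpa using ENNReal.tendsto_ofReal this
  exact tendsto_of_tendsto_of_tendsto_of_le_of_le tendsto_const_nhds h0
    (fun _ => zero_le) hb

theorem memLp_primitiveKernel (X : ℝ) :
    MemLp (primitiveKernel s X) 2 (volume.restrict s) := by
  refine MemLp.of_bound (continuous_primitiveKernel s X).aestronglyMeasurable
    ((volume.restrict s).real univ ^ (1 / (2 : ENNReal).toReal) +
      (volume.restrict s).real univ ^ (1 / (2 : ENNReal).toReal)) ?_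
  refine Eventually.of_forall fun x => (norm_sub_le _ _).trans ?_
  refine add_le_add ?_ ?_ <;>
  · refine norm_indicatorConstLp_le.trans ?_
    rw [norm_one, one_mul]
    exact Real.rpow_le_rpow measureReal_nonneg (measureReal_mono (subset_univ _)) (by positivity)

/-- The operator `f ↦ (x ↦ ∫ t in X..x, f t)` on `L²(s)`. -/
noncomputable def primitiveOperator (X : ℝ) :
    Lp ℝ 2 (volume.restrict s) →L[ℝ] Lp ℝ 2 (volume.restrict s) :=
  kernelOperator ((memLp_primitiveKernel s X).toLp _)

theorem isCompactOperator_primitiveOperator (X : ℝ) : IsCompactOperator (primitiveOperator s X) :=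
  isCompactOperator_kernelOperator _

theorem coeFn_primitiveOperator {X : ℝ} (hs : MeasurableSet s) (hX : ∀ x ∈ s, uIcc X x ⊆ s)
    (f : Lp ℝ 2 (volume.restrict s)) :
    primitiveOperator s X f =ᵐ[volume.restrict s] fun x => ∫ t in X..x, f t := by
  refine (coeFn_kernelOperator _ _).trans ?_
  filter_upwards [(memLp_primitiveKernel s X).coeFn_toLp, ae_restrict_mem hs] with x h1 h2
  rw [h1, real_inner_comm, inner_primitiveKernel s (hX x h2)]

end Primitive

end CoupledElements

namespace CoupledElements

/-! ### The energy identity -/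

theorem inner_Lp_element {M : ℕ} {h : ℝ} (hh : 0 ≤ h) (j : Fin M)
    (f g : Lp ℝ 2 (volume.restrict (element h j))) {w : ℝ → ℝ}
    (hw : w =ᵐ[volume.restrict (element h j)] g) :
    inner ℝ f g = (∫ x in (gridPoint h j - h)..gridPoint h j, f x * w x) +
      ∫ x in gridPoint h j..(gridPoint h j + h), f x * w x := by
  have hint : IntegrableOn (fun x => f x * w x) (element h j) := by
    have h1 : Integrable (fun x => inner ℝ (f x) (g x)) (volume.restrict (element h j)) :=
      L2.integrable_inner f g
    refine h1.congr ?_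
    filter_upwards [hw] with x hx
    rw [hx, real_inner_eq_re_inner, RCLike.inner_apply]
    simp [mul_comm]
  rw [intervalIntegral.integral_add_adjacent_intervals, intervalIntegral.integral_of_le
    (by linarith), ← integral_Icc_eq_integral_Ioc, L2.inner_def]
  · refine integral_congr_ae ?_
    filter_upwards [hw] with x hx
    rw [hx, real_inner_eq_re_inner, RCLike.inner_apply]
    simp [mul_comm]
  · exact (intervalIntegrable_iff_integrableOn_Icc_of_le (by linarith)).2
      (hint.mono_set (left_subset_element hh j))
  · exact (intervalIntegrable_iff_integrableOn_Icc_of_le (by linarith)).2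
      (hint.mono_set (right_subset_element hh j))

variable {M : ℕ} [NeZero M] {h : ℝ}

/-- After integration by parts on each half, the value conditions for `w'` rewrite all boundary
terms by the centre values of `w'`. After a cyclic shift of the neighbour terms, the coefficient of
the j-th centre value is exactly the flux expression of `H`, which vanishes. -/
theorem IsCoupledRep.inner_eq (hh : 0 < h) {γ : ℝ} {u v u' v' : StateSpace M h}
    {w pl pr w' pl' pr' : Fin M → ℝ → ℝ} (H : IsCoupledRep γ u v w pl pr)
    (H' : IsCoupledRep γ u' v' w' pl' pr') :
    inner ℝ v u' = -∑ j, ((∫ x in (gridPoint h j - h)..gridPoint h j, pl j x * pl' j x) +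
      ∫ x in gridPoint h j..(gridPoint h j + h), pr j x * pr' j x) := by
  have hj : ∀ j, inner ℝ (v j) (u' j) =
      pl j (gridPoint h j) * w' j (gridPoint h j)
        - pl j (gridPoint h j - h) * w' j (gridPoint h j - h)
        + pr j (gridPoint h j + h) * w' j (gridPoint h j + h)
        - pr j (gridPoint h j) * w' j (gridPoint h j)
        - ((∫ x in (gridPoint h j - h)..gridPoint h j, pl j x * pl' j x) +
          ∫ x in gridPoint h j..(gridPoint h j + h), pr j x * pr' j x) := by
    intro j
    rw [inner_Lp_element hh.le j (v j) (u' j) (H'.ae_eq j),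
      (H.deriv2_left j).integral_mul (by linarith) (H'.deriv_left j),
      (H.deriv2_right j).integral_mul (by linarith) (H'.deriv_right j)]
    ring
  have hsum : ∑ j, (pl j (gridPoint h j) * w' j (gridPoint h j)
        - pl j (gridPoint h j - h) * w' j (gridPoint h j - h)
        + pr j (gridPoint h j + h) * w' j (gridPoint h j + h)
        - pr j (gridPoint h j) * w' j (gridPoint h j)) = 0 := by
    have e1 : ∑ j, pl j (gridPoint h j - h) * (γ * w' (j - 1) (gridPoint h (j - 1))) =
        ∑ j, pl (j + 1) (gridPoint h (j + 1) - h) * (γ * w' j (gridPoint h j)) := by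
      rw [← Equiv.sum_comp (Equiv.addRight (1 : Fin M))]
      simp
    have e2 : ∑ j, pr j (gridPoint h j + h) * (γ * w' (j + 1) (gridPoint h (j + 1))) =
        ∑ j, pr (j - 1) (gridPoint h (j - 1) + h) * (γ * w' j (gridPoint h j)) := by
      rw [← Equiv.sum_comp (Equiv.subRight (1 : Fin M))]
      simp
    have e3 : ∑ j, w' j (gridPoint h j) * (pl j (gridPoint h j) - pr j (gridPoint h j)
        + γ * pr (j - 1) (gridPoint h (j - 1) + h) - γ * pl (j + 1) (gridPoint h (j + 1) - h)
        - (1 - γ) * pl j (gridPoint h j - h) + (1 - γ) * pr j (gridPoint h j + h)) = 0 :=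
      Finset.sum_eq_zero fun j _ => by rw [H.flux j, mul_zero]
    rw [← e3, ← sub_eq_zero, ← Finset.sum_sub_distrib]
    calc _ = (∑ j, pr j (gridPoint h j + h) * (γ * w' (j + 1) (gridPoint h (j + 1)))
            - ∑ j, pr (j - 1) (gridPoint h (j - 1) + h) * (γ * w' j (gridPoint h j)))
          - (∑ j, pl j (gridPoint h j - h) * (γ * w' (j - 1) (gridPoint h (j - 1)))
            - ∑ j, pl (j + 1) (gridPoint h (j + 1) - h) * (γ * w' j (gridPoint h j))) := by
          rw [← Finset.sum_sub_distrib, ← Finset.sum_sub_distrib, ← Finset.sum_sub_distrib]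
          refine Finset.sum_congr rfl fun j _ => ?_
          rw [H'.value_left j, H'.value_right j]
          ring
      _ = 0 := by rw [e1, e2]; ring
  rw [PiLp.inner_apply, Finset.sum_congr rfl fun j _ => hj j, Finset.sum_sub_distrib, hsum,
    zero_sub]

theorem coupledGraph_inner_comm (hh : 0 < h) {γ : ℝ} {x y : StateSpace M h × StateSpace M h}
    (hx : x ∈ coupledGraph M h hh γ) (hy : y ∈ coupledGraph M h hh γ) :
    inner ℝ x.2 y.1 = inner ℝ x.1 y.2 := by
  obtain ⟨w, pl, pr, H⟩ := hx
  obtain ⟨w', pl', pr', H'⟩ := hy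
  rw [H.inner_eq hh H', real_inner_comm, H'.inner_eq hh H]
  simp only [mul_comm]

theorem coupledGraph_inner_nonpos (hh : 0 < h) {γ : ℝ} {x : StateSpace M h × StateSpace M h}
    (hx : x ∈ coupledGraph M h hh γ) : inner ℝ x.2 x.1 ≤ 0 := by
  obtain ⟨w, pl, pr, H⟩ := hx
  rw [H.inner_eq hh H, neg_nonpos]
  refine Finset.sum_nonneg fun j _ => add_nonneg ?_ ?_ <;>
  exact intervalIntegral.integral_nonneg (by linarith) fun x _ => mul_self_nonneg _

/-- The operator has no positive eigenvalues. -/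
theorem eq_zero_of_mem_coupledGraph_smul (hh : 0 < h) {γ s : ℝ} (hs : 0 < s) {u : StateSpace M h}
    (hu : (u, s • u) ∈ coupledGraph M h hh γ) : u = 0 := by
  have h1 := coupledGraph_inner_nonpos hh hu
  simp only [inner_smul_left, conj_trivial, real_inner_self_eq_norm_sq] at h1
  have h2 : ‖u‖ ^ 2 ≤ 0 := by
    by_contra! hcon
    nlinarith [mul_pos hs hcon]
  exact norm_eq_zero.1 (pow_eq_zero_iff two_ne_zero |>.1 (le_antisymm h2 (sq_nonneg _)))

end CoupledElements

namespace CoupledElements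

/-! ### The primitive operator on the state space -/

section StatePrimitive

variable {M : ℕ} {h : ℝ}

instance isFiniteMeasure_restrict_element (j : Fin M) :
    IsFiniteMeasure (volume.restrict (element h j)) :=
  inferInstanceAs (IsFiniteMeasure (volume.restrict (Icc _ _)))

theorem measurableSet_element (j : Fin M) : MeasurableSet (element h j) := measurableSet_Icc

theorem gridPoint_mem_element (hh : 0 ≤ h) (j : Fin M) : gridPoint h j ∈ element h j :=
  ⟨by linarith, by linarith⟩

theorem right_mem_element (hh : 0 ≤ h) (j : Fin M) : gridPoint h j + h ∈ element h j :=
  ⟨by linarith, le_rfl⟩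

theorem left_mem_element (hh : 0 ≤ h) (j : Fin M) : gridPoint h j - h ∈ element h j :=
  ⟨le_rfl, by linarith⟩

theorem uIcc_subset_element (hh : 0 ≤ h) (j : Fin M) {x : ℝ} (hx : x ∈ element h j) :
    uIcc (gridPoint h j) x ⊆ element h j :=
  uIcc_subset_Icc (gridPoint_mem_element hh j) hx

/-- The continuous linear map into the state space with given components. -/
noncomputable def toState {Y : Type*} [NormedAddCommGroup Y] [NormedSpace ℝ Y]
    (L : ∀ j : Fin M, Y →L[ℝ] Lp ℝ 2 (volume.restrict (element h j))) :
    Y →L[ℝ] StateSpace M h :=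
  (PiLp.continuousLinearEquiv 2 ℝ _).symm.toContinuousLinearMap ∘L ContinuousLinearMap.pi L

@[simp]
theorem toState_apply {Y : Type*} [NormedAddCommGroup Y] [NormedSpace ℝ Y]
    (L : ∀ j : Fin M, Y →L[ℝ] Lp ℝ 2 (volume.restrict (element h j))) (y : Y) (j : Fin M) :
    toState L y j = L j y := rfl

/-- A component of the state as a continuous linear map. -/
noncomputable def stateProj (j : Fin M) :
    StateSpace M h →L[ℝ] Lp ℝ 2 (volume.restrict (element h j)) :=
  PiLp.proj 2 _ j

/-- The inclusion of a component into the state space. -/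
noncomputable def stateSingle (j : Fin M) :
    Lp ℝ 2 (volume.restrict (element h j)) →L[ℝ] StateSpace M h :=
  (PiLp.continuousLinearEquiv 2 ℝ _).symm.toContinuousLinearMap ∘L
    ContinuousLinearMap.single ℝ (fun j : Fin M => Lp ℝ 2 (volume.restrict (element h j))) j

theorem stateSingle_apply (i j : Fin M) (f : Lp ℝ 2 (volume.restrict (element h j))) :
    stateSingle j f i = (Pi.single j f : ∀ i, Lp ℝ 2 (volume.restrict (element h i))) i := rfl

/-- Reduces compactness of an operator into the product to compactness of its components. -/
theorem toState_eq_sum {Y : Type*} [NormedAddCommGroup Y] [NormedSpace ℝ Y]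
    (L : ∀ j : Fin M, Y →L[ℝ] Lp ℝ 2 (volume.restrict (element h j))) :
    toState L = ∑ j, stateSingle j ∘L L j := by
  ext1 y
  rw [_root_.sum_apply]
  ext1 i
  rw [WithLp.ofLp_sum, Finset.sum_apply, toState_apply, Finset.sum_eq_single i]
  · rw [ContinuousLinearMap.comp_apply, stateSingle_apply, Pi.single_eq_same]
  · intro j _ hj
    rw [ContinuousLinearMap.comp_apply, stateSingle_apply, Pi.single_eq_of_ne hj.symm]
  · intro hi
    exact absurd (Finset.mem_univ i) hi

theorem isCompactOperator_sum {Y Z ι : Type*} [NormedAddCommGroup Y] [NormedSpace ℝ Y]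
    [NormedAddCommGroup Z] [NormedSpace ℝ Z] (t : Finset ι) (L : ι → Y →L[ℝ] Z)
    (hL : ∀ j, IsCompactOperator (L j)) : IsCompactOperator (∑ j ∈ t, L j : Y →L[ℝ] Z) := by
  classical
  induction t using Finset.induction_on with
  | empty => simpa using isCompactOperator_zero
  | insert j t hj ih =>
    rw [Finset.sum_insert hj]
    exact (hL j).add ih

theorem isCompactOperator_toState {Y : Type*} [NormedAddCommGroup Y] [NormedSpace ℝ Y]
    (L : ∀ j : Fin M, Y →L[ℝ] Lp ℝ 2 (volume.restrict (element h j)))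
    (hL : ∀ j, IsCompactOperator (L j)) : IsCompactOperator (toState L) := by
  rw [toState_eq_sum]
  exact isCompactOperator_sum _ _ fun j => (hL j).clm_comp (stateSingle j)

/-- The operator which takes on each element the primitive vanishing at the centre. -/
noncomputable def statePrimitive (M : ℕ) (h : ℝ) : StateSpace M h →L[ℝ] StateSpace M h :=
  toState fun j => primitiveOperator (element h j) (gridPoint h j) ∘L stateProj j

theorem isCompactOperator_statePrimitive : IsCompactOperator (statePrimitive M h) :=
  isCompactOperator_toState _ fun _ => (isCompactOperator_primitiveOperator _ _).comp_clm _

theorem coeFn_statePrimitive (hh : 0 ≤ h) (f : StateSpace M h) (j : Fin M) :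
    statePrimitive M h f j =ᵐ[volume.restrict (element h j)]
      fun x => ∫ t in gridPoint h j..x, f j t :=
  coeFn_primitiveOperator _ (measurableSet_element j) (fun _ hx => uIcc_subset_element hh j hx) _

/-- For small `s > 0` the operator `1 - s V²`, `V` the primitive operator, is invertible. -/
theorem exists_resolvent_statePrimitive (M : ℕ) (h : ℝ) :
    ∃ s : ℝ, 0 < s ∧ ∃ R : StateSpace M h →L[ℝ] StateSpace M h,
      ∀ g, R g = g + s • statePrimitive M h (statePrimitive M h (R g)) := by
  set a := statePrimitive M h ∘L statePrimitive M h with ha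
  -- With s = 1/(‖V²‖ + 1) the norm of s V² is below 1, so 1 - s V² is inverted by its Neumann
  -- series. No boundary condition enters, hence s does not depend on γ.
  have hs : 0 < (‖a‖ + 1)⁻¹ := by positivity
  have hlt : ‖(‖a‖ + 1)⁻¹ • a‖ < 1 := by
    rw [norm_smul, Real.norm_of_nonneg hs.le, inv_mul_lt_iff₀ (by positivity)]
    linarith
  obtain ⟨R, hR⟩ := (isUnit_one_sub_of_norm_lt_one hlt).exists_right_inv
  refine ⟨_, hs, R, fun g => ?_⟩
  have h1 := DFunLike.congr_fun hR g
  simp only [_root_.mul_apply_eq_comp, _root_.sub_apply, _root_.one_apply_eq_self,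
    _root_.smul_apply, ha, ContinuousLinearMap.comp_apply] at h1
  rw [sub_eq_iff_eq_add] at h1
  exact h1

end StatePrimitive

/-! ### Solving the resolvent equation -/

/-- The free parameters of a solution on each element: the value and the left and right derivatives
at the centre. -/
abbrev CentreData (M : ℕ) : Type := Fin 3 → Fin M → ℝ

section Solve

variable {M : ℕ} {h : ℝ}

/-- The coordinates of the centre data. -/
def centreCoord (i : Fin 3) (j : Fin M) : CentreData M →L[ℝ] ℝ :=
  ContinuousLinearMap.proj j ∘L ContinuousLinearMap.proj i

/-- The state that is constant on each element, with the value at the centre. -/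
noncomputable def centreValue (M : ℕ) (h : ℝ) : CentreData M →L[ℝ] StateSpace M h :=
  toState fun j => ContinuousLinearMap.toSpanSingleton ℝ
    (indicatorConstLp 2 MeasurableSet.univ (measure_ne_top _ univ) 1) ∘L centreCoord 0 j

/-- The state that is constant on each half-element, with the value of the one-sided derivative at
the centre. -/
noncomputable def centreSlope (M : ℕ) (h : ℝ) : CentreData M →L[ℝ] StateSpace M h :=
  toState fun j => ContinuousLinearMap.toSpanSingleton ℝ
      (indicatorConstLp 2 measurableSet_Iic (measure_ne_top _ (Iic (gridPoint h j))) 1) ∘L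
        centreCoord 1 j +
    ContinuousLinearMap.toSpanSingleton ℝ
      (indicatorConstLp 2 measurableSet_Ioi (measure_ne_top _ (Ioi (gridPoint h j))) 1) ∘L
        centreCoord 2 j

theorem coeFn_centreValue (c : CentreData M) (j : Fin M) :
    centreValue M h c j =ᵐ[volume.restrict (element h j)] fun _ => c 0 j := by
  have e1 := indicatorConstLp_coeFn (p := 2) (μ := volume.restrict (element h j))
    (hs := MeasurableSet.univ) (hμs := measure_ne_top _ univ) (c := (1 : ℝ))
  have e2 := Lp.coeFn_smul (c 0 j) (indicatorConstLp 2 (μ := volume.restrict (element h j))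
    MeasurableSet.univ (measure_ne_top _ univ) (1 : ℝ))
  filter_upwards [e1, e2] with x h1 h2
  refine h2.trans ?_
  rw [Pi.smul_apply, h1]
  simp

theorem coeFn_centreSlope (c : CentreData M) (j : Fin M) :
    centreSlope M h c j =ᵐ[volume.restrict (element h j)]
      fun x => if x ≤ gridPoint h j then c 1 j else c 2 j := by
  have e1 := indicatorConstLp_coeFn (p := 2) (μ := volume.restrict (element h j))
    (hs := measurableSet_Iic) (hμs := measure_ne_top _ (Iic (gridPoint h j))) (c := (1 : ℝ))
  have e2 := indicatorConstLp_coeFn (p := 2) (μ := volume.restrict (element h j))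
    (hs := measurableSet_Ioi) (hμs := measure_ne_top _ (Ioi (gridPoint h j))) (c := (1 : ℝ))
  have e3 := Lp.coeFn_smul (c 1 j) (indicatorConstLp 2 (μ := volume.restrict (element h j))
    measurableSet_Iic (measure_ne_top _ (Iic (gridPoint h j))) (1 : ℝ))
  have e4 := Lp.coeFn_smul (c 2 j) (indicatorConstLp 2 (μ := volume.restrict (element h j))
    measurableSet_Ioi (measure_ne_top _ (Ioi (gridPoint h j))) (1 : ℝ))
  have e5 := Lp.coeFn_add (c 1 j • indicatorConstLp 2 (μ := volume.restrict (element h j))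
    measurableSet_Iic (measure_ne_top _ (Iic (gridPoint h j))) (1 : ℝ))
    (c 2 j • indicatorConstLp 2 (μ := volume.restrict (element h j))
    measurableSet_Ioi (measure_ne_top _ (Ioi (gridPoint h j))) (1 : ℝ))
  filter_upwards [e1, e2, e3, e4, e5] with x h1 h2 h3 h4 h5
  refine h5.trans ?_
  rw [Pi.add_apply, h3, h4, Pi.smul_apply, Pi.smul_apply, h1, h2]
  by_cases hx : x ≤ gridPoint h j
  · simp [hx]
  · simp [hx, not_le.1 hx]

variable (s : ℝ) (R : StateSpace M h →L[ℝ] StateSpace M h)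

/-- The solution of `s u - u'' = f` with given centre data. -/
noncomputable def solution : CentreData M × StateSpace M h →L[ℝ] StateSpace M h :=
  R ∘L ((centreValue M h + statePrimitive M h ∘L centreSlope M h).coprod
    (-(statePrimitive M h ∘L statePrimitive M h)))

/-- The second derivative of the solution. -/
noncomputable def solutionDeriv2 : CentreData M × StateSpace M h →L[ℝ] StateSpace M h :=
  s • solution R - ContinuousLinearMap.snd ℝ _ _

/-- The first derivative of the solution. -/
noncomputable def solutionDeriv : CentreData M × StateSpace M h →L[ℝ] StateSpace M h :=
  centreSlope M h ∘L ContinuousLinearMap.fst ℝ _ _ + statePrimitive M h ∘L solutionDeriv2 s R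

/-- Integrating u'' = s u - f twice from the centre gives u = g + s V²u, the equation solved by `R`.
Undoing one integration exhibits u as the centre value plus a primitive of `solutionDeriv`. -/
theorem solution_eq {s : ℝ} {R : StateSpace M h →L[ℝ] StateSpace M h}
    (hR : ∀ g, R g = g + s • statePrimitive M h (statePrimitive M h (R g)))
    (y : CentreData M × StateSpace M h) :
    solution R y = centreValue M h y.1 + statePrimitive M h (solutionDeriv s R y) := by
  set g := centreValue M h y.1 + statePrimitive M h (centreSlope M h y.1)
    - statePrimitive M h (statePrimitive M h y.2) with hg
  have h1 : solution R y = R g := by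
    simp only [solution, hg, ContinuousLinearMap.comp_apply, ContinuousLinearMap.coprod_apply,
      _root_.neg_apply, _root_.add_apply, sub_eq_add_neg]
  have h2 : solutionDeriv s R y
      = centreSlope M h y.1 + statePrimitive M h (s • solution R y - y.2) := rfl
  rw [h2, h1]
  conv_lhs => rw [hR g]
  simp only [hg, map_add, map_sub, map_smul]
  abel

/-- The value of the solution at the point `x` of element `j`. -/
noncomputable def valueTrace (j : Fin M) (x : ℝ) : CentreData M × StateSpace M h →L[ℝ] ℝ :=
  centreCoord 0 j ∘L ContinuousLinearMap.fst ℝ _ _ +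
    innerBilin _ (primitiveKernel (element h j) (gridPoint h j) x) ∘L stateProj j ∘L
      solutionDeriv s R

/-- The derivative of the solution at the left (`i = 1`) or right (`i = 2`) end `x` of
element `j`. -/
noncomputable def derivTrace (i : Fin 3) (j : Fin M) (x : ℝ) :
    CentreData M × StateSpace M h →L[ℝ] ℝ :=
  centreCoord i j ∘L ContinuousLinearMap.fst ℝ _ _ +
    innerBilin _ (primitiveKernel (element h j) (gridPoint h j) x) ∘L stateProj j ∘L
      solutionDeriv2 s R

theorem valueTrace_apply (hh : 0 ≤ h) {j : Fin M} {x : ℝ} (hx : x ∈ element h j)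
    (y : CentreData M × StateSpace M h) :
    valueTrace s R j x y = y.1 0 j + ∫ t in gridPoint h j..x, solutionDeriv s R y j t := by
  rw [← inner_primitiveKernel _ (uIcc_subset_element hh j hx)]
  rfl

theorem derivTrace_apply (hh : 0 ≤ h) (i : Fin 3) {j : Fin M} {x : ℝ} (hx : x ∈ element h j)
    (y : CentreData M × StateSpace M h) :
    derivTrace s R i j x y = y.1 i j + ∫ t in gridPoint h j..x, solutionDeriv2 s R y j t := by
  rw [← inner_primitiveKernel _ (uIcc_subset_element hh j hx)]
  rfl

variable [NeZero M]

/-- The residual in the coupling conditions, at coupling zero. -/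
noncomputable def decoupledResidual : CentreData M × StateSpace M h →L[ℝ] CentreData M :=
  ContinuousLinearMap.pi ![
    ContinuousLinearMap.pi fun j => valueTrace s R j (gridPoint h j + h) -
      centreCoord 0 j ∘L ContinuousLinearMap.fst ℝ _ _,
    ContinuousLinearMap.pi fun j => valueTrace s R j (gridPoint h j - h) -
      centreCoord 0 j ∘L ContinuousLinearMap.fst ℝ _ _,
    ContinuousLinearMap.pi fun j => (centreCoord 1 j - centreCoord 2 j) ∘L
      ContinuousLinearMap.fst ℝ _ _ - derivTrace s R 1 j (gridPoint h j - h) +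
        derivTrace s R 2 j (gridPoint h j + h)]

/-- The coefficient of `γ` in the residual in the coupling conditions. -/
noncomputable def couplingResidual : CentreData M × StateSpace M h →L[ℝ] CentreData M :=
  ContinuousLinearMap.pi ![
    ContinuousLinearMap.pi fun j => (centreCoord 0 j - centreCoord 0 (j + 1)) ∘L
      ContinuousLinearMap.fst ℝ _ _,
    ContinuousLinearMap.pi fun j => (centreCoord 0 j - centreCoord 0 (j - 1)) ∘L
      ContinuousLinearMap.fst ℝ _ _,
    ContinuousLinearMap.pi fun j => derivTrace s R 2 (j - 1) (gridPoint h (j - 1) + h) -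
      derivTrace s R 1 (j + 1) (gridPoint h (j + 1) - h) + derivTrace s R 1 j (gridPoint h j - h) -
        derivTrace s R 2 j (gridPoint h j + h)]

/-- The residual in the coupling conditions. -/
noncomputable def residual (γ : ℝ) : CentreData M × StateSpace M h →L[ℝ] CentreData M :=
  decoupledResidual s R + γ • couplingResidual s R

variable {s R}

/-- By construction u is a primitive of q, and q is on each half a primitive of the second
derivative, so only the coupling conditions are in question. They are the three rows of the
residual. -/
theorem exists_isCoupledRep_solution (hh : 0 < h)
    (hR : ∀ g, R g = g + s • statePrimitive M h (statePrimitive M h (R g)))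
    {γ : ℝ} {y : CentreData M × StateSpace M h} (hy : residual s R γ y = 0) :
    ∃ w pl pr, IsCoupledRep γ (solution R y) (solutionDeriv2 s R y) w pl pr ∧
      ∀ j, w j (gridPoint h j) = y.1 0 j ∧ pl j (gridPoint h j) = y.1 1 j ∧
        pr j (gridPoint h j) = y.1 2 j := by
  set q := solutionDeriv s R y with hq
  set v := solutionDeriv2 s R y with hv
  have hqv : q = centreSlope M h y.1 + statePrimitive M h v := rfl
  have hqae : ∀ j, q j =ᵐ[volume.restrict (element h j)] fun x =>
      (if x ≤ gridPoint h j then y.1 1 j else y.1 2 j) + ∫ t in gridPoint h j..x, v j t := by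
    intro j
    have e := Lp.coeFn_add (centreSlope M h y.1 j) (statePrimitive M h v j)
    filter_upwards [e, coeFn_centreSlope y.1 j, coeFn_statePrimitive hh.le v j] with x h1 h2 h3
    rw [← h2, ← h3]
    exact h1
  have huae : ∀ j, (fun x => y.1 0 j + ∫ t in gridPoint h j..x, q j t)
      =ᵐ[volume.restrict (element h j)] solution R y j := by
    intro j
    rw [solution_eq hR y]
    have e := Lp.coeFn_add (centreValue M h y.1 j) (statePrimitive M h q j)
    filter_upwards [e, coeFn_centreValue (h := h) y.1 j, coeFn_statePrimitive hh.le q j]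
      with x h1 h2 h3
    rw [← h2, ← h3]
    exact h1.symm
  have hml : ∀ (f : StateSpace M h) j,
      MemLp (f j) 2 (volume.restrict (Icc (gridPoint h j - h) (gridPoint h j))) := fun f j =>
    (Lp.memLp (f j)).mono_measure (Measure.restrict_mono (left_subset_element hh.le j) le_rfl)
  have hmr : ∀ (f : StateSpace M h) j,
      MemLp (f j) 2 (volume.restrict (Icc (gridPoint h j) (gridPoint h j + h))) := fun f j =>
    (Lp.memLp (f j)).mono_measure (Measure.restrict_mono (right_subset_element hh.le j) le_rfl)
  have hXl : ∀ j : Fin M, gridPoint h j ∈ Icc (gridPoint h j - h) (gridPoint h j) :=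
    fun j => ⟨by linarith, le_rfl⟩
  have hXr : ∀ j : Fin M, gridPoint h j ∈ Icc (gridPoint h j) (gridPoint h j + h) :=
    fun j => ⟨le_rfl, by linarith⟩
  have r0 : ∀ j, valueTrace s R j (gridPoint h j + h) y - y.1 0 j
      + γ * (y.1 0 j - y.1 0 (j + 1)) = 0 := fun j => congrFun (congrFun hy 0) j
  have r1 : ∀ j, valueTrace s R j (gridPoint h j - h) y - y.1 0 j
      + γ * (y.1 0 j - y.1 0 (j - 1)) = 0 := fun j => congrFun (congrFun hy 1) j
  have r2 : ∀ j, (y.1 1 j - y.1 2 j) - derivTrace s R 1 j (gridPoint h j - h) y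
      + derivTrace s R 2 j (gridPoint h j + h) y
      + γ * (derivTrace s R 2 (j - 1) (gridPoint h (j - 1) + h) y
        - derivTrace s R 1 (j + 1) (gridPoint h (j + 1) - h) y
        + derivTrace s R 1 j (gridPoint h j - h) y
        - derivTrace s R 2 j (gridPoint h j + h) y) = 0 := fun j => congrFun (congrFun hy 2) j
  have hrm := fun j : Fin M => right_mem_element (h := h) hh.le j
  have hlm := fun j : Fin M => left_mem_element (h := h) hh.le j
  simp only [valueTrace_apply s R hh.le (hrm _), valueTrace_apply s R hh.le (hlm _)] at r0 r1
  simp only [derivTrace_apply s R hh.le _ (hrm _), derivTrace_apply s R hh.le _ (hlm _)] at r2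
  refine ⟨fun j x => y.1 0 j + ∫ t in gridPoint h j..x, q j t,
    fun j x => y.1 1 j + ∫ t in gridPoint h j..x, v j t,
    fun j x => y.1 2 j + ∫ t in gridPoint h j..x, v j t,
    ⟨huae, fun j => ?_, fun j => ?_,
      fun j => isH1Deriv_of_primitive (hXl j) (hml v j) fun x _ => rfl,
      fun j => isH1Deriv_of_primitive (hXr j) (hmr v j) fun x _ => rfl,
      fun j => ?_, fun j => ?_, fun j => ?_⟩, fun j => by simp⟩
  · refine (isH1Deriv_of_primitive (hXl j) (hml q j) fun x _ => rfl).congr ?_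
    filter_upwards [ae_restrict_of_ae_restrict_of_subset (left_subset_element hh.le j) (hqae j),
      ae_restrict_mem measurableSet_Icc] with x h1 h2
    rw [h1, if_pos h2.2]
  · refine (isH1Deriv_of_primitive (hXr j) (hmr q j) fun x _ => rfl).congr ?_
    -- The case split defining the slope assigns the centre to the left half, so the right half must
    -- discard this null set.
    have hne : ∀ᵐ x ∂(volume.restrict (Icc (gridPoint h j) (gridPoint h j + h))),
        x ≠ gridPoint h j := ae_restrict_of_ae (by simp [ae_iff])
    filter_upwards [ae_restrict_of_ae_restrict_of_subset (right_subset_element hh.le j) (hqae j),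
      ae_restrict_mem measurableSet_Icc, hne] with x h1 h2 h3
    rw [h1, if_neg (not_le.2 (lt_of_le_of_ne h2.1 h3.symm))]
  · simp only [intervalIntegral.integral_same, add_zero]
    linear_combination r0 j
  · simp only [intervalIntegral.integral_same, add_zero]
    linear_combination r1 j
  · simp only [intervalIntegral.integral_same, add_zero]
    linear_combination r2 j

/-- Centre data in the kernel give a solution of u'' = s u that satisfies the coupling conditions.
It vanishes by the energy identity, and then so do its centre value and slopes. In finite dimension
injectivity is enough. -/
theorem isUnit_residual (hh : 0 < h) (hs : 0 < s)
    (hR : ∀ g, R g = g + s • statePrimitive M h (statePrimitive M h (R g))) (γ : ℝ) :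
    IsUnit (residual s R γ ∘L ContinuousLinearMap.inl ℝ _ _) := by
  set b : CentreData M →L[ℝ] CentreData M := residual s R γ ∘L ContinuousLinearMap.inl ℝ _ _
    with hb
  have hinj : Function.Injective b := by
    rw [injective_iff_map_eq_zero]
    intro c hc
    obtain ⟨w, pl, pr, H, hX⟩ := exists_isCoupledRep_solution hh hR (y := (c, 0)) hc
    have h2 : solutionDeriv2 s R (c, 0) = s • solution R (c, 0) := by
      change s • solution R (c, 0) - 0 = _
      rw [sub_zero]
    have hu : solution R (c, 0) = 0 := by
      refine eq_zero_of_mem_coupledGraph_smul hh hs (γ := γ) ?_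
      rw [← h2]
      exact ⟨w, pl, pr, H⟩
    have hw : ∀ j, w j =ᵐ[volume.restrict (element h j)] 0 := fun j => by
      refine (H.ae_eq j).trans ?_
      rw [hu]
      exact Lp.coeFn_zero ℝ 2 _
    have hwl := fun j => ae_restrict_of_ae_restrict_of_subset (left_subset_element hh.le j) (hw j)
    have hwr := fun j => ae_restrict_of_ae_restrict_of_subset (right_subset_element hh.le j) (hw j)
    have hpl := fun j => (H.deriv_left j).ae_zero (by linarith) (hwl j)
    have hpr := fun j => (H.deriv_right j).ae_zero (by linarith) (hwr j)
    have e0 : ∀ j, w j (gridPoint h j) = 0 := fun j =>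
      Measure.eqOn_Icc_of_ae_eq volume (by linarith : gridPoint h j - h < gridPoint h j).ne (hwl j)
        ((H.deriv_left j).continuousOn (by linarith)) continuousOn_const ⟨by linarith, le_rfl⟩
    have e1 : ∀ j, pl j (gridPoint h j) = 0 := fun j =>
      Measure.eqOn_Icc_of_ae_eq volume (by linarith : gridPoint h j - h < gridPoint h j).ne (hpl j)
        ((H.deriv2_left j).continuousOn (by linarith)) continuousOn_const ⟨by linarith, le_rfl⟩
    have e2 : ∀ j, pr j (gridPoint h j) = 0 := fun j =>
      Measure.eqOn_Icc_of_ae_eq volume (by linarith : gridPoint h j < gridPoint h j + h).ne (hpr j)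
        ((H.deriv2_right j).continuousOn (by linarith)) continuousOn_const ⟨le_rfl, by linarith⟩
    ext i j
    fin_cases i
    · exact (hX j).1.symm.trans (e0 j)
    · exact (hX j).2.1.symm.trans (e1 j)
    · exact (hX j).2.2.symm.trans (e2 j)
  rw [ContinuousLinearMap.isUnit_iff_bijective]
  exact ⟨hinj, (LinearMap.injective_iff_surjective (f := (b : CentreData M →ₗ[ℝ] CentreData M))).1
    hinj⟩

/-- The resolvents of the coupled operators are compact and depend continuously on the coupling. -/
theorem exists_resolvent (M : ℕ) [NeZero M] (h : ℝ) (hh : 0 < h) :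
    ∃ s : ℝ, 0 < s ∧ ∃ T : ℝ → StateSpace M h →L[ℝ] StateSpace M h,
      (∀ γ, IsCompactOperator (T γ)) ∧
      (∀ γ f, (T γ f, s • T γ f - f) ∈ coupledGraph M h hh γ) ∧ Continuous T := by
  obtain ⟨s, hs, R, hR⟩ := exists_resolvent_statePrimitive M h
  set b : ℝ → CentreData M →L[ℝ] CentreData M :=
    fun γ => residual s R γ ∘L ContinuousLinearMap.inl ℝ _ _ with hb
  set g : ℝ → StateSpace M h →L[ℝ] CentreData M :=
    fun γ => residual s R γ ∘L ContinuousLinearMap.inr ℝ _ _ with hg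
  have hbu : ∀ γ, IsUnit (b γ) := isUnit_residual hh hs hR
  have hres : Continuous (residual s R : ℝ → _) :=
    continuous_const.add (continuous_id.smul continuous_const)
  -- For given f, the equation b(γ)c + g(γ)f = 0 determines the centre data c, which are then
  -- substituted into the solution. The first term is compact because it contains V², the second
  -- because it factors through a finite-dimensional space.
  refine ⟨s, hs, fun γ => solution R ∘L ContinuousLinearMap.inr ℝ _ _ -
    (solution R ∘L ContinuousLinearMap.inl ℝ _ _) ∘L (Ring.inverse (b γ) ∘L g γ), fun γ => ?_,
    fun γ f => ?_, ?_⟩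
  · refine IsCompactOperator.sub ?_ ?_
    · have : (solution R ∘L ContinuousLinearMap.inr ℝ _ _ : StateSpace M h →L[ℝ] StateSpace M h)
          = -(R ∘L (statePrimitive M h ∘L statePrimitive M h)) := by
        ext1 f
        simp [solution]
      rw [this]
      exact ((isCompactOperator_statePrimitive.comp_clm _).clm_comp R).neg
    · exact (isCompactOperator_of_locallyCompactSpace_rng
        (solution R ∘L ContinuousLinearMap.inl ℝ _ _)).comp_clm _
  · set c := -(Ring.inverse (b γ) (g γ f)) with hc
    have hy : residual s R γ (c, f) = 0 := by
      have h1 : residual s R γ (c, f) = b γ c + g γ f := by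
        simp only [hb, hg, ContinuousLinearMap.comp_apply, ← map_add]
        simp
      have h2 := DFunLike.congr_fun (Ring.mul_inverse_cancel (b γ) (hbu γ)) (g γ f)
      rw [_root_.mul_apply_eq_comp, _root_.one_apply_eq_self] at h2
      rw [h1, hc, map_neg, h2, neg_add_cancel]
    have hsol : solution R (c, f) = (solution R ∘L ContinuousLinearMap.inr ℝ _ _ -
        (solution R ∘L ContinuousLinearMap.inl ℝ _ _) ∘L (Ring.inverse (b γ) ∘L g γ)) f := by
      have h1 : (c, f) = ((0, f) : CentreData M × StateSpace M h) -
          (Ring.inverse (b γ) (g γ f), 0) := by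
        rw [hc, Prod.mk_sub_mk, zero_sub, sub_zero]
      rw [h1, map_sub, _root_.sub_apply]
      simp only [ContinuousLinearMap.comp_apply, ContinuousLinearMap.inr_apply,
        ContinuousLinearMap.inl_apply]
    obtain ⟨w, pl, pr, H, -⟩ := exists_isCoupledRep_solution hh hR hy
    rw [← hsol]
    exact ⟨w, pl, pr, H⟩
  · have hbc : Continuous b := hres.clm_comp continuous_const
    have hgc : Continuous g := hres.clm_comp continuous_const
    have hic : Continuous fun γ => Ring.inverse (b γ) := by
      rw [continuous_iff_continuousAt]
      intro γ
      obtain ⟨u, hu⟩ := hbu γ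
      have h1 := NormedRing.inverse_continuousAt u
      rw [hu] at h1
      exact ContinuousAt.comp (f := b) h1 hbc.continuousAt
    exact continuous_const.sub (continuous_const.clm_comp (hic.clm_comp hgc))

end Solve

end CoupledElements

namespace CoupledElements

/-! ### The eigenvalues of the decoupled operator -/

theorem IsH1Deriv.mono_right {a b x : ℝ} {w p : ℝ → ℝ} (H : IsH1Deriv a b w p) (hx : x ≤ b) :
    IsH1Deriv a x w p :=
  ⟨H.1.mono_measure (Measure.restrict_mono (Icc_subset_Icc le_rfl hx) le_rfl),
    fun t ht => H.2 t ⟨ht.1, ht.2.trans hx⟩⟩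

theorem isH1Deriv_of_hasDerivAt (a b : ℝ) {w p : ℝ → ℝ} (hw : ∀ x, HasDerivAt w (p x) x)
    (hp : Continuous p) : IsH1Deriv a b w p := by
  refine ⟨?_, fun x _ => ?_⟩
  · obtain ⟨C, hC⟩ := isCompact_Icc.exists_bound_of_continuousOn (s := Icc a b) hp.continuousOn
    refine MemLp.of_bound hp.aestronglyMeasurable C ?_
    filter_upwards [ae_restrict_mem measurableSet_Icc] with x hx using hC x hx
  · rw [intervalIntegral.integral_eq_sub_of_hasDerivAt (fun t _ => hw t)
      (hp.intervalIntegrable _ _)]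
    ring

theorem hasDerivAt_cos_mul_sub (ω x t : ℝ) :
    HasDerivAt (fun t => Real.cos (ω * (x - t))) (ω * Real.sin (ω * (x - t))) t := by
  have h1 : HasDerivAt (fun t => ω * (x - t)) (-ω) t := by
    simpa using ((hasDerivAt_id t).const_sub x).const_mul ω
  convert h1.cos using 1
  ring

theorem hasDerivAt_sin_mul_sub (ω x t : ℝ) :
    HasDerivAt (fun t => Real.sin (ω * (x - t))) (-(ω * Real.cos (ω * (x - t)))) t := by
  have h1 : HasDerivAt (fun t => ω * (x - t)) (-ω) t := by
    simpa using ((hasDerivAt_id t).const_sub x).const_mul ω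
  convert h1.sin using 1
  ring

/-- The solutions of `w'' = -ω² w` in terms of their initial data. -/
theorem IsH1Deriv.eq_of_oscillator {a b ω : ℝ} {w p v : ℝ → ℝ} (H : IsH1Deriv a b w p)
    (H' : IsH1Deriv a b p v)
    (hv : v =ᵐ[volume.restrict (Icc a b)] fun x => -ω ^ 2 * w x) {x : ℝ} (hx : x ∈ Icc a b) :
    ω * w x = ω * w a * Real.cos (ω * (x - a)) + p a * Real.sin (ω * (x - a)) ∧
      p x = p a * Real.cos (ω * (x - a)) - ω * w a * Real.sin (ω * (x - a)) := by
  have G := (H'.congr hv).mono_right hx.2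
  have F := H.mono_right hx.2
  -- Testing w' = p and p' = -ω²w against the kernels cos ω(x - t) and sin ω(x - t) makes the
  -- integrals cancel and leaves boundary terms only.
  have hc := isH1Deriv_of_hasDerivAt a x (hasDerivAt_cos_mul_sub ω x) (by fun_prop)
  have hs := isH1Deriv_of_hasDerivAt a x (hasDerivAt_sin_mul_sub ω x) (by fun_prop)
  have e1 := F.integral_mul hx.1 hc
  have e2 := G.integral_mul hx.1 hs
  have e3 := F.integral_mul hx.1 hs
  have e4 := G.integral_mul hx.1 hc
  have i1 : ∫ t in a..x, w t * (ω * Real.sin (ω * (x - t))) =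
      ω * ∫ t in a..x, w t * Real.sin (ω * (x - t)) := by
    rw [← intervalIntegral.integral_const_mul]
    congr 1
    ext t
    ring
  have i2 : ∫ t in a..x, -ω ^ 2 * w t * Real.sin (ω * (x - t)) =
      -ω ^ 2 * ∫ t in a..x, w t * Real.sin (ω * (x - t)) := by
    rw [← intervalIntegral.integral_const_mul]
    congr 1
    ext t
    ring
  have i3 : ∫ t in a..x, p t * -(ω * Real.cos (ω * (x - t))) =
      -ω * ∫ t in a..x, p t * Real.cos (ω * (x - t)) := by
    rw [← intervalIntegral.integral_const_mul]
    congr 1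
    ext t
    ring
  have i4 : ∫ t in a..x, w t * -(ω * Real.cos (ω * (x - t))) =
      -ω * ∫ t in a..x, w t * Real.cos (ω * (x - t)) := by
    rw [← intervalIntegral.integral_const_mul]
    congr 1
    ext t
    ring
  have i5 : ∫ t in a..x, -ω ^ 2 * w t * Real.cos (ω * (x - t)) =
      -ω ^ 2 * ∫ t in a..x, w t * Real.cos (ω * (x - t)) := by
    rw [← intervalIntegral.integral_const_mul]
    congr 1
    ext t
    ring
  have i6 : ∫ t in a..x, p t * (ω * Real.sin (ω * (x - t))) =
      ω * ∫ t in a..x, p t * Real.sin (ω * (x - t)) := by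
    rw [← intervalIntegral.integral_const_mul]
    congr 1
    ext t
    ring
  rw [i1] at e1
  rw [i2, i3] at e2
  rw [i4] at e3
  rw [i5, i6] at e4
  simp only [sub_self, mul_zero, Real.cos_zero, Real.sin_zero, mul_one] at e1 e2 e3 e4
  constructor
  · linear_combination -ω * e1 - e2
  · linear_combination ω * e3 - e4

variable {M : ℕ} [NeZero M] {h : ℝ}

theorem mem_opEigenspace_coupledOperator (hh : 0 < h) (γ μ : ℝ) (u : StateSpace M h) :
    u ∈ opEigenspace (coupledOperator M h hh γ) μ ↔ (u, μ • u) ∈ coupledGraph M h hh γ := by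
  rw [opEigenspace, Submodule.mem_comap, graph_coupledOperator]
  rfl

/-- Without coupling, w takes the same value W at the centre and at both ends of an element. If sin
ωh ≠ 0, this value determines the slopes on both halves, and the flux condition then forces W = 0.
-/
theorem eq_zero_of_sin_ne_zero (hh : 0 < h) {ω : ℝ} (hω : 0 < ω) (hsin : Real.sin (ω * h) ≠ 0)
    {u : StateSpace M h} (hu : (u, -ω ^ 2 • u) ∈ coupledGraph M h hh 0) : u = 0 := by
  obtain ⟨w, pl, pr, H⟩ := hu
  ext j : 1
  have hv : ((-ω ^ 2 • u) j : ℝ → ℝ) =ᵐ[volume.restrict (element h j)]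
      fun x => -ω ^ 2 * w j x := by
    filter_upwards [Lp.coeFn_smul (-ω ^ 2) (u j), H.ae_eq j] with x h1 h2
    rw [h2]
    exact h1
  have hl := fun {x} hx => (H.deriv_left j).eq_of_oscillator (H.deriv2_left j)
    (ae_restrict_of_ae_restrict_of_subset (left_subset_element hh.le j) hv) (x := x) hx
  have hr := fun {x} hx => (H.deriv_right j).eq_of_oscillator (H.deriv2_right j)
    (ae_restrict_of_ae_restrict_of_subset (right_subset_element hh.le j) hv) (x := x) hx
  obtain ⟨l1, l2⟩ := hl (right_mem_Icc.2 (by linarith))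
  obtain ⟨r1, r2⟩ := hr (right_mem_Icc.2 (by linarith))
  have v1 := H.value_right j
  have v2 := H.value_left j
  have fl := H.flux j
  simp only [sub_zero, one_mul, zero_mul, add_zero, sub_sub_cancel, add_sub_cancel_left]
    at l1 l2 r1 r2 v1 v2 fl
  rw [v2] at l1 l2
  rw [v1] at r1
  set W := w j (gridPoint h j)
  set P := pl j (gridPoint h j - h)
  set Q := pr j (gridPoint h j)
  set c := Real.cos (ω * h)
  set s := Real.sin (ω * h)
  have hcs : s ^ 2 + c ^ 2 = 1 := Real.sin_sq_add_cos_sq _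
  have hP : P * s = ω * W * (1 - c) := by linarith
  have hQ : Q * s = ω * W * (1 - c) := by linarith
  have hs2 : 0 < s ^ 2 := by positivity
  -- The flux condition reads (P + Q)(c - 1) = 2ωWs. Multiplying by s eliminates P and Q.
  have hW0 : ω * W * ((1 - c) ^ 2 + s ^ 2) = 0 := by
    rw [l2, r2] at fl
    linear_combination (-s / 2) * fl + ((c - 1) / 2) * hP + ((c - 1) / 2) * hQ
  have hW : W = 0 := by
    have h1 : (1 - c) ^ 2 + s ^ 2 ≠ 0 := by positivity
    rcases mul_eq_zero.1 hW0 with h2 | h2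
    · exact (mul_eq_zero.1 h2).resolve_left hω.ne'
    · exact absurd h2 h1
  have hP0 : P = 0 := by
    rw [hW] at hP
    simpa [hsin] using hP
  have hQ0 : Q = 0 := by
    rw [hW] at hQ
    simpa [hsin] using hQ
  have hw : ∀ x ∈ element h j, w j x = 0 := fun x hx => by
    rw [element_eq_union hh.le] at hx
    rcases hx with hx | hx
    · have := (hl hx).1
      rw [v2, hW, hP0] at this
      simpa [hω.ne'] using this
    · have := (hr hx).1
      rw [hW, hQ0] at this
      simpa [hω.ne'] using this
  refine Lp.ext ?_
  refine (H.ae_eq j).symm.trans (EventuallyEq.trans ?_ (Lp.coeFn_zero ℝ 2 _).symm)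
  filter_upwards [ae_restrict_mem (measurableSet_element j)] with x hx using hw x hx

/-- A profile on `[-h, h]` satisfying the decoupled conditions, repeated on each element, is an
eigenfunction. -/
theorem exists_mem_coupledGraph_of_profile (hh : 0 < h) {φ ψ : ℝ → ℝ} {μ : ℝ}
    (hφ : ∀ x, HasDerivAt φ (ψ x) x) (hψ : ∀ x, HasDerivAt ψ (-μ * φ x) x)
    (hr : φ h = φ 0) (hl : φ (-h) = φ 0) (hf : ψ h = ψ (-h))
    {x₀ : ℝ} (hx₀ : x₀ ∈ Icc (-h) h) (hne : φ x₀ ≠ 0) :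
    ∃ u : StateSpace M h, u ≠ 0 ∧ (u, -μ • u) ∈ coupledGraph M h hh 0 := by
  have hφc : Continuous φ := continuous_iff_continuousAt.2 fun x => (hφ x).continuousAt
  have hψc : Continuous ψ := continuous_iff_continuousAt.2 fun x => (hψ x).continuousAt
  have hφ' : ∀ X x, HasDerivAt (fun x => φ (x - X)) (ψ (x - X)) x := fun X x =>
    (hφ (x - X)).comp_sub_const x X
  have hψ' : ∀ X x, HasDerivAt (fun x => ψ (x - X)) (-μ * φ (x - X)) x := fun X x =>
    (hψ (x - X)).comp_sub_const x X
  have hm : ∀ j : Fin M, MemLp (fun x => φ (x - gridPoint h j)) 2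
      (volume.restrict (element h j)) := fun j => by
    have h1 : Continuous fun x => φ (x - gridPoint h j) := by fun_prop
    -- The primitive serves only to extract square integrability of its continuous derivative.
    exact (isH1Deriv_of_hasDerivAt (w := fun x => ∫ t in (0 : ℝ)..x, φ (t - gridPoint h j)) _ _
      (fun x => intervalIntegral.integral_hasDerivAt_right (h1.intervalIntegrable _ _)
        (h1.stronglyMeasurableAtFilter _ _) h1.continuousAt) h1).1
  let u : StateSpace M h := WithLp.toLp 2 fun j => (hm j).toLp _
  have hu : ∀ j, (fun x => φ (x - gridPoint h j)) =ᵐ[volume.restrict (element h j)] u j :=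
    fun j => (hm j).coeFn_toLp.symm
  have hv : ∀ j, (fun x => -μ * φ (x - gridPoint h j)) =ᵐ[volume.restrict (element h j)]
      (-μ • u) j := fun j => by
    filter_upwards [hu j, Lp.coeFn_smul (-μ) (u j)] with x h1 h2
    rw [h1]
    exact h2.symm
  refine ⟨u, fun h0 => hne ?_, fun j x => φ (x - gridPoint h j), fun j x => ψ (x - gridPoint h j),
    fun j x => ψ (x - gridPoint h j), hu, fun j => ?_, fun j => ?_, fun j => ?_, fun j => ?_,
    fun j => ?_, fun j => ?_, fun j => ?_⟩
  · have h1 := hu 0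
    rw [h0] at h1
    have h2 : (fun x => φ (x - gridPoint h (0 : Fin M)))
        =ᵐ[volume.restrict (element h (0 : Fin M))] 0 := h1.trans (Lp.coeFn_zero ℝ 2 _)
    have h3 := Measure.eqOn_Icc_of_ae_eq volume (by linarith : gridPoint h (0 : Fin M) - h <
      gridPoint h (0 : Fin M) + h).ne h2 (by fun_prop) continuousOn_const
    have h4 := h3 (x := x₀ + gridPoint h (0 : Fin M))
      ⟨by linarith [hx₀.1], by linarith [hx₀.2]⟩
    simpa using h4
  · exact isH1Deriv_of_hasDerivAt _ _ (hφ' _) (by fun_prop)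
  · exact isH1Deriv_of_hasDerivAt _ _ (hφ' _) (by fun_prop)
  · exact (isH1Deriv_of_hasDerivAt _ _ (hψ' _) (by fun_prop)).congr
      (ae_restrict_of_ae_restrict_of_subset (left_subset_element hh.le j) (hv j))
  · exact (isH1Deriv_of_hasDerivAt _ _ (hψ' _) (by fun_prop)).congr
      (ae_restrict_of_ae_restrict_of_subset (right_subset_element hh.le j) (hv j))
  · simp [hr]
  · simp [hl]
  · simp [hf]

/-- Constants serve for k = 0. Otherwise sin(kπx/h) vanishes at the centre and both ends and has an
even derivative; it equals 1 at x = h/(2k). -/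
theorem exists_ne_zero_mem_limitEigenspace (M : ℕ) [NeZero M] (h : ℝ) (hh : 0 < h) (k : ℕ) :
    ∃ u ∈ limitEigenspace M h hh k, u ≠ 0 := by
  have key : ∃ u : StateSpace M h, u ≠ 0 ∧
      (u, -limitEigenvalue h k • u) ∈ coupledGraph M h hh 0 := by
    rcases Nat.eq_zero_or_pos k with rfl | hk
    · exact exists_mem_coupledGraph_of_profile hh (φ := fun _ => 1) (ψ := fun _ => 0)
        (fun x => hasDerivAt_const x _)
        (fun x => by simpa [limitEigenvalue] using hasDerivAt_const x (0 : ℝ)) rfl rfl rfl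
        (x₀ := 0) ⟨by linarith, hh.le⟩ one_ne_zero
    · set ω := (k : ℝ) * Real.pi / h with hω
      have hk' : (0 : ℝ) < k := by exact_mod_cast hk
      have hωh : ω * h = k * Real.pi := by rw [hω]; field_simp
      have hω2 : limitEigenvalue h k = ω ^ 2 := by rw [hω, limitEigenvalue, div_pow, mul_pow]
      have hlin : ∀ x, HasDerivAt (fun x => ω * x) ω x := fun x => by
        simpa using (hasDerivAt_id x).const_mul ω
      refine exists_mem_coupledGraph_of_profile hh (φ := fun x => Real.sin (ω * x))
        (ψ := fun x => ω * Real.cos (ω * x)) (fun x => ?_) (fun x => ?_) ?_ ?_ ?_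
        (x₀ := h / (2 * k)) ⟨?_, ?_⟩ ?_
      · convert (hlin x).sin using 1
        ring
      · refine ((hlin x).cos.const_mul ω).congr_deriv ?_
        rw [hω2]
        ring
      · simp [hωh, Real.sin_nat_mul_pi]
      · simp [hωh, Real.sin_nat_mul_pi]
      · simp
      · have : 0 < h / (2 * k) := by positivity
        linarith
      · rw [div_le_iff₀ (by positivity)]
        have : (1 : ℝ) ≤ k := by exact_mod_cast hk
        nlinarith
      · have : ω * (h / (2 * k)) = Real.pi / 2 := by
          rw [hω]
          field_simp
        simp [this]
  obtain ⟨u, hu, hmem⟩ := key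
  exact ⟨u, (mem_opEigenspace_coupledOperator hh 0 _ u).2 hmem, hu⟩

theorem opEigenspace_ne_bot_iff (M : ℕ) [NeZero M] (h : ℝ) (hh : 0 < h) (μ : ℝ) :
    opEigenspace (coupledOperator M h hh 0) (-μ) ≠ ⊥ ↔ ∃ k : ℕ, μ = limitEigenvalue h k := by
  constructor
  · intro hne
    obtain ⟨u, hu, hu0⟩ := Submodule.exists_mem_ne_zero_of_ne_bot hne
    rw [mem_opEigenspace_coupledOperator] at hu
    rcases lt_trichotomy μ 0 with hμ | hμ | hμ
    · exact absurd (eq_zero_of_mem_coupledGraph_smul hh (by linarith) hu) hu0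
    · exact ⟨0, by simp [hμ, limitEigenvalue]⟩
    · have hsq : Real.sqrt μ ^ 2 = μ := Real.sq_sqrt hμ.le
      by_cases hsin : Real.sin (Real.sqrt μ * h) = 0
      · obtain ⟨n, hn⟩ := Real.sin_eq_zero_iff.1 hsin
        -- The zeros of sine are indexed by integers, and only n² enters the eigenvalue.
        refine ⟨n.natAbs, ?_⟩
        rw [limitEigenvalue, Nat.cast_natAbs, Int.cast_abs, sq_abs, ← mul_pow, hn, mul_pow, hsq]
        field_simp
      · refine absurd (eq_zero_of_sin_ne_zero hh (Real.sqrt_pos.2 hμ) hsin ?_) hu0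
        rwa [hsq]
  · rintro ⟨k, rfl⟩
    obtain ⟨u, hu, hu0⟩ := exists_ne_zero_mem_limitEigenspace M h hh k
    exact fun hbot => hu0 ((Submodule.eq_bot_iff _).1 hbot u hu)

theorem strictMono_limitEigenvalue (hh : 0 < h) : StrictMono (limitEigenvalue h) := by
  intro k l hkl
  have h1 : (k : ℝ) ^ 2 < (l : ℝ) ^ 2 := by
    have : (k : ℝ) < l := by exact_mod_cast hkl
    exact pow_lt_pow_left₀ this (Nat.cast_nonneg k) two_ne_zero
  have := Real.pi_pos
  unfold limitEigenvalue
  gcongr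

theorem limitEigenvalue_nonneg (h : ℝ) (k : ℕ) : 0 ≤ limitEigenvalue h k := by
  unfold limitEigenvalue
  positivity

end CoupledElements

namespace CoupledElements

/-! ### Eigenbases of the coupled operators and spectral sequences of their resolvents -/

section Resolvent

variable {M : ℕ} [NeZero M] {h : ℝ} {hh : 0 < h} {γ s : ℝ}
  {T : StateSpace M h →L[ℝ] StateSpace M h}

/-- The hypothesis makes `T` a right inverse of s - 𝓛_γ. Since 𝓛_γ has no positive eigenvalue, it is
a left inverse too. -/
theorem resolvent_apply (hs : 0 < s) (hT : ∀ f, (T f, s • T f - f) ∈ coupledGraph M h hh γ)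
    {u v : StateSpace M h} (huv : (u, v) ∈ coupledGraph M h hh γ) : T (s • u - v) = u := by
  have h1 := (coupledGraph M h hh γ).sub_mem (hT (s • u - v)) huv
  refine sub_eq_zero.1 (eq_zero_of_mem_coupledGraph_smul hh hs (γ := γ) ?_)
  convert h1 using 1
  rw [Prod.mk_sub_mk, smul_sub]
  congr 1
  abel

theorem isSymmetric_resolvent (hT : ∀ f, (T f, s • T f - f) ∈ coupledGraph M h hh γ) :
    T.IsSymmetric := by
  intro f g
  have h1 := coupledGraph_inner_comm hh (hT f) (hT g)
  simp only [inner_sub_left, inner_sub_right, inner_smul_left, inner_smul_right,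
    conj_trivial] at h1
  simp only [ContinuousLinearMap.coe_coe]
  linarith

theorem inner_resolvent_pos (hs : 0 < s)
    (hT : ∀ f, (T f, s • T f - f) ∈ coupledGraph M h hh γ) {f : StateSpace M h} (hf : f ≠ 0) :
    0 < inner ℝ (T f) f := by
  have h1 := coupledGraph_inner_nonpos hh (hT f)
  simp only [inner_sub_left, inner_smul_left, conj_trivial, real_inner_self_eq_norm_sq] at h1
  have hne : T f ≠ 0 := fun h0 => hf (by
    have h2 := coupledGraph_functional M h hh γ _ (hT f) h0
    simpa [h0] using h2)
  have h3 : 0 < s * ‖T f‖ ^ 2 := mul_pos hs (pow_pos (norm_pos_iff.2 hne) 2)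
  rw [real_inner_comm]
  linarith

theorem opEigenspace_eq_eigenspace (hs : 0 < s)
    (hT : ∀ f, (T f, s • T f - f) ∈ coupledGraph M h hh γ) {lam : ℝ} (hlam : 0 < s + lam) :
    opEigenspace (coupledOperator M h hh γ) (-lam) =
      Module.End.eigenspace (T : StateSpace M h →ₗ[ℝ] StateSpace M h) (s + lam)⁻¹ := by
  ext u
  rw [mem_opEigenspace_coupledOperator, Module.End.mem_eigenspace_iff,
    ContinuousLinearMap.coe_coe]
  constructor
  · intro hu
    have h1 := resolvent_apply hs hT hu
    rw [neg_smul, sub_neg_eq_add, ← add_smul, map_smul] at h1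
    conv_rhs => rw [← h1]
    rw [smul_smul, inv_mul_cancel₀ hlam.ne', one_smul]
  · intro hu
    have h1 := (coupledGraph M h hh γ).smul_mem (s + lam) (hT u)
    rw [hu] at h1
    convert h1 using 1
    rw [Prod.smul_mk, smul_sub, smul_smul, smul_smul, smul_smul, mul_inv_cancel₀ hlam.ne',
      one_smul, ← sub_smul]
    congr 2
    field_simp
    ring

theorem nonneg_of_opEigenspace {lam : ℝ} {u : StateSpace M h} (hu0 : u ≠ 0)
    (hu : u ∈ opEigenspace (coupledOperator M h hh γ) (-lam)) : 0 ≤ lam := by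
  by_contra! hcon
  exact hu0 (eq_zero_of_mem_coupledGraph_smul hh (by linarith)
    ((mem_opEigenspace_coupledOperator hh γ _ u).1 hu))

theorem IsOrderedEigenbasis.nonneg {lam : ℕ → ℝ} {e : ℕ → StateSpace M h}
    (H : IsOrderedEigenbasis (coupledOperator M h hh γ) lam e) (n : ℕ) : 0 ≤ lam n :=
  nonneg_of_opEigenspace (H.orthonormal.ne_zero n) (H.eigen n)

theorem IsOrderedEigenbasis.isSpectralSeq (hs : 0 < s)
    (hT : ∀ f, (T f, s • T f - f) ∈ coupledGraph M h hh γ) {lam : ℕ → ℝ}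
    {e : ℕ → StateSpace M h} (H : IsOrderedEigenbasis (coupledOperator M h hh γ) lam e) :
    IsSpectralSeq T (fun n => (s + lam n)⁻¹) e where
  anti m n hmn := by
    have h1 := H.nonneg m
    have h2 := H.mono hmn
    exact inv_anti₀ (by linarith) (by linarith)
  orthonormal := H.orthonormal
  complete := H.complete
  apply n := by
    have h1 := H.eigen n
    have h2 := H.nonneg n
    rw [opEigenspace_eq_eigenspace hs hT (by linarith), Module.End.mem_eigenspace_iff] at h1
    exact h1

theorem IsSpectralSeq.isOrderedEigenbasis (hs : 0 < s)
    (hT : ∀ f, (T f, s • T f - f) ∈ coupledGraph M h hh γ) {μ : ℕ → ℝ}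
    {e : ℕ → StateSpace M h} (H : IsSpectralSeq T μ e) (hμ : ∀ n, 0 < μ n) :
    IsOrderedEigenbasis (coupledOperator M h hh γ) (fun n => (μ n)⁻¹ - s) e where
  mono m n hmn := sub_le_sub_right (inv_anti₀ (hμ n) (H.anti hmn)) s
  orthonormal := H.orthonormal
  complete := H.complete
  eigen n := by
    have h1 : s + ((μ n)⁻¹ - s) = (μ n)⁻¹ := by ring
    rw [opEigenspace_eq_eigenspace hs hT (by rw [h1]; exact inv_pos.2 (hμ n)), h1, inv_inv,
      Module.End.mem_eigenspace_iff]
    exact H.apply n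

end Resolvent

/-- Eigenvectors of T_0 for the distinct values (s + λ_k)⁻¹ are independent. Infinite dimension is
what lets the spectral sequence be indexed by ℕ. -/
theorem not_finiteDimensional_stateSpace (M : ℕ) [NeZero M] (h : ℝ) (hh : 0 < h) :
    ¬ FiniteDimensional ℝ (StateSpace M h) := by
  intro hfd
  obtain ⟨s, hs, T, -, hT, -⟩ := exists_resolvent M h hh
  choose u hu hu0 using exists_ne_zero_mem_limitEigenspace M h hh
  have hpos : ∀ k, 0 < s + limitEigenvalue h k := fun k => by
    linarith [limitEigenvalue_nonneg h k]
  have hli : LinearIndependent ℝ u := by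
    refine Module.End.eigenvectors_linearIndependent'
      (T 0 : StateSpace M h →ₗ[ℝ] StateSpace M h) (fun k => (s + limitEigenvalue h k)⁻¹) ?_ u ?_
    · intro k l hkl
      exact (strictMono_limitEigenvalue hh).injective (add_left_cancel (inv_injective hkl))
    · intro k
      exact ⟨(opEigenspace_eq_eigenspace hs (hT 0) (hpos k)).le (hu k), hu0 k⟩
  exact not_finite_iff_infinite.2 (inferInstanceAs (Infinite ℕ)) hli.finite

/-- The case γ = 0 supplies the reference enumeration against which the groups are counted. -/
theorem exists_isOrderedEigenbasis (M : ℕ) [NeZero M] (h : ℝ) (hh : 0 < h) (γ : ℝ) :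
    ∃ lam e, IsOrderedEigenbasis (coupledOperator M h hh γ) lam e := by
  obtain ⟨s, hs, T, hTc, hT, -⟩ := exists_resolvent M h hh
  obtain ⟨μ, e, H, hμ⟩ := exists_isSpectralSeq (hTc γ) (isSymmetric_resolvent (hT γ))
    (fun x hx => inner_resolvent_pos hs (hT γ) hx) (not_finiteDimensional_stateSpace M h hh)
  exact ⟨_, e, H.isOrderedEigenbasis hs (hT γ) hμ⟩

/-- Ensures that `finrank` in `mult` is a genuine dimension and not its default value 0. -/
theorem finiteDimensional_limitEigenspace (M : ℕ) [NeZero M] (h : ℝ) (hh : 0 < h) (k : ℕ) :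
    FiniteDimensional ℝ (limitEigenspace M h hh k) := by
  obtain ⟨s, hs, T, hTc, hT, -⟩ := exists_resolvent M h hh
  have hpos : 0 < s + limitEigenvalue h k := by linarith [limitEigenvalue_nonneg h k]
  rw [limitEigenspace, opEigenspace_eq_eigenspace hs (hT 0) hpos]
  exact ContinuousLinearMap.finite_dimensional_eigenspace (hTc 0) _ (inv_pos.2 hpos).ne'

/-! ### Grouping the eigenvalues -/

theorem mem_iff_lt_ncard_of_isLowerSet {S : Set ℕ} (hS : IsLowerSet S) (hfin : S.Finite) (n : ℕ) :
    n ∈ S ↔ n < S.ncard := by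
  constructor
  · intro hn
    have h1 : (Iic n) ⊆ S := fun m hm => hS hm hn
    have h2 := ncard_le_ncard h1 hfin
    rw [← Finset.coe_Iic, ncard_coe_finset, Nat.card_Iic] at h2
    omega
  · intro hn
    by_contra hnS
    have h1 : S ⊆ Iio n := fun m hm => by
      by_contra hmn
      exact hnS (hS (not_lt.1 hmn) hm)
    have h2 := ncard_le_ncard h1 (finite_Iio n)
    rw [← Finset.coe_Iio, ncard_coe_finset, Nat.card_Iio] at h2
    omega

/-- The position of the groups of equal values in a monotone sequence with known
multiplicities. -/
theorem lt_iff_lt_sum_of_ncard {lam Λ : ℕ → ℝ} (hlam : Monotone lam) (hΛ : StrictMono Λ)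
    (hval : ∀ n, ∃ k, lam n = Λ k) {m : ℕ → ℕ}
    (hm : ∀ k, {n | lam n = Λ k}.Finite ∧ {n | lam n = Λ k}.ncard = m k) (k n : ℕ) :
    lam n < Λ k ↔ n < ∑ i ∈ Finset.range k, m i := by
  have key : ∀ k, {n | lam n < Λ k}.Finite ∧
      {n | lam n < Λ k}.ncard = ∑ i ∈ Finset.range k, m i := by
    intro k
    induction k with
    | zero =>
      have : {n | lam n < Λ 0} = ∅ := by
        refine eq_empty_of_forall_notMem fun n hn => ?_
        obtain ⟨l, hl⟩ := hval n
        have h1 : lam n < Λ 0 := hn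
        rw [hl] at h1
        exact absurd (hΛ.monotone (Nat.zero_le l)) (not_le.2 h1)
      simp [this]
    | succ k ih =>
      have : {n | lam n < Λ (k + 1)} = {n | lam n < Λ k} ∪ {n | lam n = Λ k} := by
        ext n
        obtain ⟨l, hl⟩ := hval n
        simp only [mem_ofPred_eq, mem_union, hl, hΛ.lt_iff_lt, hΛ.injective.eq_iff]
        omega
      rw [this]
      refine ⟨ih.1.union (hm k).1, ?_⟩
      rw [ncard_union_eq _ ih.1 (hm k).1, ih.2, (hm k).2, Finset.sum_range_succ]
      rw [disjoint_left]
      intro n h1 h2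
      exact (ne_of_lt h1) h2
  rw [← (key k).2, ← mem_iff_lt_ncard_of_isLowerSet _ (key k).1]
  · rfl
  · exact fun a b hab hb => (hlam hab).trans_lt hb

/-- Each λ_k occurs exactly m_k times in any ordered eigenbasis, as seen from the resolvent, so m_0
+ ⋯ + m_{k-1} counts the eigenvalues below λ_k. -/
theorem lt_limitEigenvalue_iff {M : ℕ} [NeZero M] {h : ℝ} {hh : 0 < h} {lam : ℕ → ℝ}
    {e : ℕ → StateSpace M h} (H : IsOrderedEigenbasis (coupledOperator M h hh 0) lam e)
    (k n : ℕ) : lam n < limitEigenvalue h k ↔ n < groupStart M h hh k := by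
  obtain ⟨s, hs, T, hTc, hT, -⟩ := exists_resolvent M h hh
  refine lt_iff_lt_sum_of_ncard H.mono (strictMono_limitEigenvalue hh) (fun n => ?_)
    (fun k => ?_) k n
  · rw [← opEigenspace_ne_bot_iff M h hh]
    intro hbot
    exact H.orthonormal.ne_zero n ((Submodule.eq_bot_iff _).1 hbot _ (H.eigen n))
  · have hpos : 0 < s + limitEigenvalue h k := by linarith [limitEigenvalue_nonneg h k]
    have hE := opEigenspace_eq_eigenspace hs (hT 0) hpos
    have hfd : FiniteDimensional ℝ (Module.End.eigenspace
        (T 0 : StateSpace M h →ₗ[ℝ] StateSpace M h) (s + limitEigenvalue h k)⁻¹) :=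
      ContinuousLinearMap.finite_dimensional_eigenspace (hTc 0) _ (inv_pos.2 hpos).ne'
    have h1 := (H.isSpectralSeq hs (hT 0)).ncard_eq_finrank (isSymmetric_resolvent (hT 0))
      (s + limitEigenvalue h k)⁻¹
    rw [← hE] at h1
    simp only [inv_inj, add_right_inj] at h1
    exact h1

theorem groupStart_succ (M : ℕ) [NeZero M] (h : ℝ) (hh : 0 < h) (k : ℕ) :
    groupStart M h hh (k + 1) = groupStart M h hh k + mult M h hh k :=
  Finset.sum_range_succ _ _

theorem eq_limitEigenvalue {M : ℕ} [NeZero M] {h : ℝ} {hh : 0 < h} {lam : ℕ → ℝ}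
    {e : ℕ → StateSpace M h} (H : IsOrderedEigenbasis (coupledOperator M h hh 0) lam e)
    {k i : ℕ} (hi : i < mult M h hh k) :
    lam (groupStart M h hh k + i) = limitEigenvalue h k := by
  obtain ⟨l, hl⟩ := (opEigenspace_ne_bot_iff M h hh (lam (groupStart M h hh k + i))).1
    (fun hbot => H.orthonormal.ne_zero _ ((Submodule.eq_bot_iff _).1 hbot _ (H.eigen _)))
  have h1 : ¬ lam (groupStart M h hh k + i) < limitEigenvalue h k := by
    rw [lt_limitEigenvalue_iff H]
    omega
  have h2 : lam (groupStart M h hh k + i) < limitEigenvalue h (k + 1) := by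
    rw [lt_limitEigenvalue_iff H, groupStart_succ]
    exact Nat.add_lt_add_left hi _
  rw [hl, (strictMono_limitEigenvalue hh).lt_iff_lt] at h1 h2
  rw [hl]
  congr 1
  omega

/-! ### Convergence of groups of eigenvectors -/

section Convergence

variable {E : Type*} [NormedAddCommGroup E] [InnerProductSpace ℝ E]

/-- By monotonicity only the two neighbours of the group, at a - 1 and b, have to be controlled.
Convergence of each single eigenvalue therefore yields a gap uniform over infinitely many indices.
-/
theorem exists_gap_of_tendsto {μ : ℕ → ℕ → ℝ} {ν : ℕ → ℝ} (hμ : ∀ n, Antitone (μ n))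
    (hlim : ∀ i, Tendsto (fun n => μ n i) atTop (𝓝 (ν i))) {c : ℝ} {a b : ℕ}
    (ha : ∀ i < a, c < ν i) (hb : ν b < c) :
    ∃ δ > 0, ∀ᶠ n in atTop, ∀ i ∉ Finset.Ico a b, δ ≤ |μ n i - c| := by
  obtain ⟨ε, hε, hεa⟩ : ∃ ε > 0, ∀ᶠ n in atTop, ∀ i < a, ε ≤ μ n i - c := by
    rcases Nat.eq_zero_or_pos a with rfl | hapos
    · exact ⟨1, one_pos, Eventually.of_forall fun n i hi => absurd hi (Nat.not_lt_zero i)⟩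
    · have h1 := ha (a - 1) (by omega)
      refine ⟨(ν (a - 1) - c) / 2, by linarith, ?_⟩
      filter_upwards [(hlim (a - 1)).eventually_const_lt
        (show c + (ν (a - 1) - c) / 2 < ν (a - 1) by linarith)] with n hn i hi
      have h2 := hμ n (show i ≤ a - 1 by omega)
      linarith
  refine ⟨min ε ((c - ν b) / 2), lt_min hε (by linarith), ?_⟩
  filter_upwards [hεa, (hlim b).eventually_lt_const
    (show ν b < c - (c - ν b) / 2 by linarith)] with n hna hnb i hi
  rw [Finset.mem_Ico, not_and_or, not_le, not_lt] at hi
  rcases hi with hi | hi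
  · exact (min_le_left _ _).trans ((hna i hi).trans (le_abs_self _))
  · have h2 := hμ n hi
    refine (min_le_right _ _).trans (le_trans ?_ (neg_le_abs _))
    linarith

/-- Each coefficient of `v` is at most ‖v‖ in absolute value. The crude sum suffices because the
group size stays fixed. -/
theorem IsSpectralSeq.norm_apply_sub_smul_le {T : E →L[ℝ] E} {μ : ℕ → ℝ} {e : ℕ → E}
    (H : IsSpectralSeq T μ e) (c : ℝ) (a m : ℕ) {v : E}
    (hv : v ∈ Submodule.span ℝ (range fun i : Fin m => e (a + i))) :
    ‖T v - c • v‖ ≤ (∑ i : Fin m, |μ (a + i) - c|) * ‖v‖ := by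
  obtain ⟨x, rfl⟩ := (Submodule.mem_span_range_iff_exists_fun ℝ).1 hv
  set v := ∑ i, x i • e (a + i) with hvdef
  have hon : Orthonormal ℝ (fun i : Fin m => e (a + i)) :=
    H.orthonormal.comp _ fun i j hij => Fin.ext (Nat.add_left_cancel hij)
  have hx : ∀ i, |x i| ≤ ‖v‖ := fun i => by
    have h1 : inner ℝ (e (a + i)) v = x i := hon.inner_right_fintype x i
    rw [← h1]
    refine (abs_real_inner_le_norm _ _).trans ?_
    rw [H.orthonormal.1, one_mul]
  have h2 : T v - c • v = ∑ i : Fin m, (x i * (μ (a + i) - c)) • e (a + i) := by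
    rw [hvdef, map_sum, Finset.smul_sum, ← Finset.sum_sub_distrib]
    refine Finset.sum_congr rfl fun i _ => ?_
    rw [map_smul, H.apply, smul_smul, smul_smul, ← sub_smul]
    congr 1
    ring
  rw [h2, Finset.sum_mul]
  refine (norm_sum_le _ _).trans (Finset.sum_le_sum fun i _ => ?_)
  rw [norm_smul, H.orthonormal.1, mul_one, Real.norm_eq_abs, abs_mul, mul_comm]
  exact mul_le_mul_of_nonneg_left (hx i) (abs_nonneg _)

/-- Mosco convergence of the spans of a group of eigenvectors of norm-convergent symmetric
operators, when the group is separated from the remaining eigenvalues in the limit. -/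
theorem moscoConverges_span [CompleteSpace E] {T : ℕ → E →L[ℝ] E} {T₀ : E →L[ℝ] E}
    (hT : ∀ n, (T n).IsSymmetric) (hT₀ : T₀.IsSymmetric) (hlim : Tendsto T atTop (𝓝 T₀))
    {μ : ℕ → ℕ → ℝ} {e : ℕ → ℕ → E} (H : ∀ n, IsSpectralSeq (T n) (μ n) (e n)) {ν : ℕ → ℝ}
    (hμ : ∀ i, Tendsto (fun n => μ n i) atTop (𝓝 (ν i))) {c : ℝ} {a m : ℕ}
    (ha : ∀ i < a, c < ν i) (hc : ∀ i < m, ν (a + i) = c) (hb : ν (a + m) < c) :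
    MoscoConverges
      (fun n => (Submodule.span ℝ (range fun i : Fin m => e n (a + i)) : Set E))
      (Module.End.eigenspace (T₀ : E →ₗ[ℝ] E) c : Set E) := by
  refine ⟨fun u hu => ?_, fun φ hφ v hv u hu => ?_⟩
  · have hu' : T₀ u = c • u := Module.End.mem_eigenspace_iff.1 hu
    -- The recovery sequence is the orthogonal projection of `u` onto the group. Its error is at
    -- most ‖T n - T₀‖‖u‖/δ, where δ is the spectral gap.
    refine ⟨fun n => ∑ i ∈ Finset.Ico a (a + m), (inner ℝ (e n i) u : ℝ) • e n i,
      fun n => ?_, ?_⟩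
    · refine Submodule.sum_mem _ fun i hi => Submodule.smul_mem _ _ (Submodule.subset_span ?_)
      rw [Finset.mem_Ico] at hi
      exact ⟨⟨i - a, by omega⟩, by simp only [Nat.add_sub_cancel' hi.1]⟩
    · obtain ⟨δ, hδ, hgap⟩ := exists_gap_of_tendsto (fun n => (H n).anti) hμ ha hb
      rw [tendsto_iff_norm_sub_tendsto_zero]
      have h0 : Tendsto (fun n => ‖T n - T₀‖ * ‖u‖ / δ) atTop (𝓝 0) := by
        simpa using ((tendsto_iff_norm_sub_tendsto_zero.1 hlim).mul_const ‖u‖).div_const δ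
      refine squeeze_zero' (Eventually.of_forall fun n => norm_nonneg _) ?_ h0
      filter_upwards [hgap] with n hn
      rw [le_div_iff₀ hδ, norm_sub_rev, mul_comm]
      refine ((H n).mul_norm_sub_sum_le (hT n) _ hδ.le hn u).trans ?_
      rw [← hu', ← _root_.sub_apply]
      exact (T n - T₀).le_opNorm u
  · refine Module.End.mem_eigenspace_iff.2 ?_
    refine apply_eq_smul_of_weak_limit (T := fun n => T (φ n)) hT₀
      (hlim.comp hφ.tendsto_atTop) (v := v)
      (d := fun n => ∑ i : Fin m, |μ (φ n) (a + i) - c|) ?_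
      (fun n => (H (φ n)).norm_apply_sub_smul_le c a m (hv n)) hu
    have h1 : Tendsto (fun n => ∑ i : Fin m, |μ n (a + i) - c|) atTop (𝓝 0) := by
      have h2 : ∀ i : Fin m, Tendsto (fun n => |μ n (a + i) - c|) atTop (𝓝 0) := fun i => by
        have h3 := ((hμ (a + i)).sub_const c).abs
        rwa [hc i i.2, sub_self, abs_zero] at h3
      simpa using tendsto_finsetSum Finset.univ fun i _ => h2 i
    exact h1.comp hφ.tendsto_atTop

end Convergence

end CoupledElements

/-! ### Convergence of eigenvalues and eigenspaces as the coupling vanishes -/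

theorem mainTheorem3 (M : ℕ) [NeZero M] (h : ℝ) (hh : 0 < h) :
    -- for every coupling, the operator has a complete orthonormal system of eigenfunctions
    (∀ γ ∈ Set.Ioc (0 : ℝ) 1, ∃ (lam : ℕ → ℝ) (e : ℕ → CoupledElements.StateSpace M h),
      CoupledElements.IsOrderedEigenbasis (CoupledElements.coupledOperator M h hh γ) lam e) ∧
    -- the eigenvalues of the decoupled operator are `k²π²/h²`, with finite multiplicities `m_k`
    (∀ μ : ℝ, CoupledElements.opEigenspace (CoupledElements.coupledOperator M h hh 0) (-μ) ≠ ⊥ ↔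
      ∃ k : ℕ, μ = CoupledElements.limitEigenvalue h k) ∧
    (∀ k : ℕ, FiniteDimensional ℝ (CoupledElements.limitEigenspace M h hh k)) ∧
    -- for every choice of the eigenfunctions
    ∀ (lam : ℝ → ℕ → ℝ) (e : ℝ → ℕ → CoupledElements.StateSpace M h),
      (∀ γ ∈ Set.Ioc (0 : ℝ) 1, CoupledElements.IsOrderedEigenbasis
        (CoupledElements.coupledOperator M h hh γ) (lam γ) (e γ)) →
      ∀ k : ℕ,
        -- the `k`-th group of `m_k` eigenvalues converges to `k²π²/h²`
        (∀ i < CoupledElements.mult M h hh k,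
          Filter.Tendsto (fun γ => lam γ (CoupledElements.groupStart M h hh k + i))
            (nhdsWithin 0 (Set.Ioi 0)) (nhds (CoupledElements.limitEigenvalue h k))) ∧
        -- the spaces spanned by the `k`-th group of eigenfunctions have dimension `m_k` and
        -- Mosco converge to the eigenspace of the decoupled operator
        (∀ γ ∈ Set.Ioc (0 : ℝ) 1,
          Module.finrank ℝ (CoupledElements.groupSpan M h hh (e γ) k) =
            CoupledElements.mult M h hh k) ∧
        ∀ γs : ℕ → ℝ, (∀ n, γs n ∈ Set.Ioc (0 : ℝ) 1) →
          Filter.Tendsto γs Filter.atTop (nhds 0) →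
          CoupledElements.MoscoConverges
            (fun n => (CoupledElements.groupSpan M h hh (e (γs n)) k : Set (CoupledElements.StateSpace M h)))
            (CoupledElements.limitEigenspace M h hh k : Set (CoupledElements.StateSpace M h)) := by
  open CoupledElements in
  refine ⟨fun γ _ => exists_isOrderedEigenbasis M h hh γ, opEigenspace_ne_bot_iff M h hh,
    finiteDimensional_limitEigenspace M h hh, fun lam e H k => ?_⟩
  obtain ⟨s, hs, T, hTc, hT, hcont⟩ := exists_resolvent M h hh
  obtain ⟨lam₀, e₀, H₀⟩ := exists_isOrderedEigenbasis M h hh 0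
  have S₀ := H₀.isSpectralSeq hs (hT 0)
  have hsym := fun γ => isSymmetric_resolvent (hT γ)
  -- Weyl's inequality bounds the difference by ‖T γ - T 0‖ whatever eigenbases were chosen.
  have hconv : ∀ i, Tendsto (fun γ => (s + lam γ i)⁻¹) (𝓝[>] 0) (𝓝 (s + lam₀ i)⁻¹) := fun i => by
    rw [tendsto_iff_norm_sub_tendsto_zero]
    have h0 : Tendsto (fun γ => ‖T γ - T 0‖) (𝓝[>] 0) (𝓝 0) :=
      tendsto_iff_norm_sub_tendsto_zero.1 ((hcont.tendsto 0).mono_left nhdsWithin_le_nhds)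
    refine squeeze_zero' (Eventually.of_forall fun γ => norm_nonneg _) ?_ h0
    filter_upwards [Ioc_mem_nhdsGT (zero_lt_one (α := ℝ))] with γ hγ
    exact ((H γ hγ).isSpectralSeq hs (hT γ)).abs_sub_le S₀ (hsym γ) (hsym 0) i
  refine ⟨fun i hi => ?_, fun γ hγ => ?_, fun γs hγs hγs0 => ?_⟩
  · have hpos : s + lam₀ (groupStart M h hh k + i) ≠ 0 := by
      have := H₀.nonneg (groupStart M h hh k + i)
      positivity
    have h1 := ((hconv (groupStart M h hh k + i)).inv₀ (inv_ne_zero hpos)).sub_const s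
    simpa only [inv_inv, add_sub_cancel_left, eq_limitEigenvalue H₀ hi] using h1
  · have hli : LinearIndependent ℝ
        (fun i : Fin (mult M h hh k) => e γ (groupStart M h hh k + i)) :=
      ((H γ hγ).orthonormal.comp _ fun i j hij =>
        Fin.ext (Nat.add_left_cancel hij)).linearIndependent
    rw [groupSpan, finrank_span_eq_card hli, Fintype.card_fin]
  · have hpos : 0 < s + limitEigenvalue h k := by linarith [limitEigenvalue_nonneg h k]
    have hγs' : Tendsto γs atTop (𝓝[>] 0) :=
      tendsto_nhdsWithin_iff.2 ⟨hγs0, Eventually.of_forall fun n => (hγs n).1⟩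
    rw [limitEigenspace, opEigenspace_eq_eigenspace hs (hT 0) hpos]
    refine moscoConverges_span (T := fun n => T (γs n)) (ν := fun i => (s + lam₀ i)⁻¹)
      (fun n => hsym _) (hsym 0)
      ((hcont.tendsto 0).comp hγs0) (fun n => (H _ (hγs n)).isSpectralSeq hs (hT _))
      (fun i => (hconv i).comp hγs') (fun i hi => ?_) (fun i hi => ?_) ?_
    · have h1 := (lt_limitEigenvalue_iff H₀ k i).2 hi
      have h2 := H₀.nonneg i
      exact inv_strictAnti₀ (by linarith) (by linarith)
    · rw [eq_limitEigenvalue H₀ hi]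
    -- The first index after the group is where the next group starts, so its eigenvalue is at least
    -- λ_{k+1}.
    · have h1 : limitEigenvalue h k < lam₀ (groupStart M h hh k + mult M h hh k) := by
        refine (strictMono_limitEigenvalue hh (Nat.lt_succ_self k)).trans_le (not_lt.1 ?_)
        rw [lt_limitEigenvalue_iff H₀, groupStart_succ]
        exact lt_irrefl _
      exact inv_strictAnti₀ hpos (by linarith)
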